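/- Proposition. Every monotone irreducible pattern that is solvable by singleton arc consistency (SAC) occurs in at least one of the twelve patterns $Q_1,Q_2,R_1,\dots,R_{10}$ listed below. **Instances.** A binary CSP instance consists of a finite set $X$ of variables, a finite set $D$ of values, a domain $D(x)\subseteq D$ for each variable $x$, and a relation $R(x,y)\subseteq D^2$ for each pair of distinct variables, with $(a,b)\in R(x,y)$ if and only if $(b,a)\in R(y,x)$. A solution is a map $s$ with $s(x)\in D(x)$ for all $x$ and $(s(x),s(y))\in R(x,y)$ for all $x\ne y$. The points of the instance are the pairs $(x,a)$ with $a\in D(x)$; for $x\neq y$ the points $(x,a),(y,b)$ form a positive edge if $(a,b)\in R(x,y)$ and a negative edge otherwise. Deleting the constraint between $x\ne y$ means replacing $R(x,y)$ by $D(x)\times D(y)$ and $R(y,x)$ by $D(y)\times D(x)$. **SAC.** An instance is arc consistent if for every $x$, every $a\in D(x)$ and every $y\neq x$ there is $b\in D(y)$ with $(a,b)\in R(x,y)$. A value $a\in D(x)$ is singleton arc consistent if the instance obtained by replacing $D(x)$ with $\{a\}$ can be made arc consistent, by removing values from domains, without emptying any domain; an instance is SAC if all its domain values are singleton arc consistent.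 Establishing SAC means passing to the largest subdomains for which the instance is SAC. SAC decides an instance $I$ if, whenever all domains are non-empty after establishing SAC, $I$ has a solution. **Patterns.** A pattern is a finite set of points, each belonging to one variable of a finite set, with a partial function assigning the value positive or negative to some of the unordered pairs of points of distinct variables (the positive and negative edges). A pattern $P$ occurs in a pattern or instance $Q$ if there is a map from the points of $P$ to the points of $Q$ that sends two points to points of the same variable if and only if they belong to the same variable, positive edges to positive edges, and negative edges to negative edges. $P$ is SAC-solvable if SAC decides every instance in which $P$ does not occur. $P$ is monotone if the class of instances in which $P$ does not occur is closed under deleting constraints. $P$ is irreducible if it has neither of the following: - mergeable points: two distinct points $p,q$ of the same variable for which there is no point $r$ such that one of $pr,qr$ is a positive edge and the other a negative edge; - a dangling point: a point on at most one positive edge and on no negative edge. **The twelve patterns.** In each, the points of a variable are listed in braces. - $Q_{1}$: variables $\{a\},\ \{b_1,b_2,b_3\},\ \{c\},\ \{e\}$; negative edges $ab_2,\ b_3c,\ b_1e$; positive edges $ab_3,\ b_1c,\ b_2e$. - $Q_{2}$: variables $\{a\},\ \{b_1,b_2\},\ \{c\},\ \{e\}$; negative edges $ab_2,\ b_2c,\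 b_1e$; positive edges $ab_1,\ b_2e$. - $R_{1}$: variables $\{a\},\ \{b_1,b_2\},\ \{c_1,c_2\},\ \{d\}$; negative edges $ab_2,\ b_2c_2,\ c_1d$; positive edges $ab_1,\ b_2c_1,\ c_2d,\ b_1c_1$. - $R_{2}$: variables $\{a_1,a_2\},\ \{b_1,b_2\},\ \{c_1,c_2\},\ \{d\}$; negative edges $a_2b_2,\ b_2c_2,\ c_1d$; positive edges $a_1b_2,\ b_2c_1,\ c_2d,\ b_1c_2,\ a_1b_1$. - $R_{3}$: variables $\{a\},\ \{b\},\ \{c_1,c_2\},\ \{d_1,d_2\}$; negative edges $ab,\ bc_2,\ c_1d_1$; positive edges $bc_1,\ c_1d_2,\ c_2d_2$. - $R_{4}$: variables $\{a\},\ \{b_1,b_2\},\ \{c_1,c_2\},\ \{d\}$; negative edges $ab_2,\ b_2c_2,\ c_1d$; positive edges $b_1c_1,\ c_2d,\ b_1c_2$. - $R_{5}$: variables $\{a\},\ \{b_1,b_2\},\ \{c_1,c_2\},\ \{d\}$; negative edges $ab_2,\ b_1c_1,\ c_2d$; positive edges $ab_1,\ b_2c_1,\ c_1d,\ b_1c_2$.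 - $R_{6}$: variables $\{a_1,a_2\},\ \{b_1,b_2\},\ \{c_1,c_2\},\ \{d\}$; negative edges $a_2b_2,\ b_1c_1,\ c_2d$; positive edges $a_1b_2,\ b_2c_1,\ c_1d,\ b_1c_2,\ a_1b_1$. - $R_{7}$: variables $\{a\},\ \{b_1,b_2,b_3\},\ \{c_1,c_2\},\ \{d\}$; negative edges $ab_2,\ b_1c_1,\ c_2d$; positive edges $ab_3,\ b_3c_1,\ b_2c_1,\ b_1c_2,\ c_1d$. - $R_{8}$: variables $\{a\},\ \{b_1,b_2,b_3\},\ \{c_1,c_2\},\ \{d\}$; negative edges $ab_2,\ b_1c_1,\ c_2d$; positive edges $ab_3,\ ab_1,\ b_3c_1,\ b_1c_2,\ c_1d$. - $R_{9}$: variables $\{a\},\ \{b_1,b_2,b_3\},\ \{c_1,c_2\},\ \{d\}$; negative edges $ab_2,\ b_1c_1,\ c_2d$; positive edges $ab_3,\ ab_1,\ b_3c_1,\ b_2c_2,\ c_1d$. - $R_{10}$: variables $\{a\},\ \{b_1,b_2\},\ \{c_1,c_2\},\ \{d\}$; negative edges $ab_2,\ b_1c_1,\ c_2d$; positive edges $ab_1,\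 b_2c_2,\ c_1d,\ b_1c_2$. -/

import Mathlib

namespace BinCSP

/-! ## Binary CSP instances and singleton arc consistency -/

/-- A binary CSP instance: finitely many variables, a finite set of values, for each variable its
own domain, and a constraint relation for each pair of distinct variables (`rel x x` plays no
role). The points of the instance are the pairs `(x, a)` with `a ∈ dom x`. -/
structure Inst where
  Var : Type
  Val : Type
  finite_var : Finite Var
  finite_val : Finite Val
  dom : Var → Set Val
  rel : Var → Var → Val → Val → Prop
  rel_symm : ∀ x y a b, x ≠ y → (rel x y a b ↔ rel y x b a)

namespace Inst

/-- A solution: a choice of domain values satisfying all constraints. -/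
def IsSolution (I : Inst) (s : I.Var → I.Val) : Prop :=
  (∀ x, s x ∈ I.dom x) ∧ ∀ x y, x ≠ y → I.rel x y (s x) (s y)

/-- The same instance with the domains replaced by `E`. -/
def withDom (I : Inst) (E : I.Var → Set I.Val) : Inst := { I with dom := E }

/-- The instance obtained by removing from the domain of `x` all values other than `a`. -/
def assign (I : Inst) (x : I.Var) (a : I.Val) : Inst :=
  I.withDom fun y => {b | b ∈ I.dom y ∧ (y = x → b = a)}

/-- Every domain value has a support at every other variable. -/
def IsAC (I : Inst) : Prop :=
  ∀ x, ∀ a ∈ I.dom x, ∀ y, y ≠ x → ∃ b ∈ I.dom y, I.rel x y a b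

/-- The result of establishing arc consistency: the restriction of `I` to its largest arc
consistent subdomains (see `acClosure_isAC` and `subset_acClosure`). -/
def acClosure (I : Inst) : Inst :=
  I.withDom fun x => {a | ∃ E : I.Var → Set I.Val,
    (∀ y, E y ⊆ I.dom y) ∧ (I.withDom E).IsAC ∧ a ∈ E x}

/-- The value `a` of `x` is singleton arc consistent: after `x` is assigned `a`, the instance can
be made arc consistent without emptying any domain. -/
def IsSACValue (I : Inst) (x : I.Var) (a : I.Val) : Prop :=
  ∀ y : I.Var, ((I.assign x a).acClosure.dom y).Nonempty

/-- Every domain value is singleton arc consistent. -/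
def IsSAC (I : Inst) : Prop :=
  ∀ x, ∀ a ∈ I.dom x, I.IsSACValue x a

/-- The result of establishing singleton arc consistency: the restriction of `I` to its largest
singleton arc consistent subdomains (see `sacClosure_isSAC` and `subset_sacClosure`). -/
def sacClosure (I : Inst) : Inst :=
  I.withDom fun x => {a | ∃ E : I.Var → Set I.Val,
    (∀ y, E y ⊆ I.dom y) ∧ (I.withDom E).IsSAC ∧ a ∈ E x}

/-- SAC decides `I`: if all domains are non-empty after establishing singleton arc consistency,
then `I` has a solution. -/
def SACDecides (I : Inst) : Prop :=
  (∀ x : I.Var, (I.sacClosure.dom x).Nonempty) → ∃ s, I.IsSolution s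

theorem acClosure_isAC (I : Inst) : I.acClosure.IsAC := by
  rintro x a ⟨E, hE, hac, ha⟩ y hy
  obtain ⟨b, hb, hab⟩ := hac x a ha y hy
  exact ⟨b, ⟨E, hE, hac, hb⟩, hab⟩

theorem subset_acClosure (I : Inst) (E : I.Var → Set I.Val) (hE : ∀ y, E y ⊆ I.dom y)
    (hac : (I.withDom E).IsAC) (x : I.Var) : E x ⊆ I.acClosure.dom x :=
  fun _ ha => ⟨E, hE, hac, ha⟩

theorem sacClosure_isSAC (I : Inst) : I.sacClosure.IsSAC := by
  rintro x a ⟨E, hE, hsac, ha⟩ y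
  obtain ⟨b, F, hF, hac, hb⟩ := hsac x a ha y
  exact ⟨b, F, fun z c hc => ⟨⟨E, hE, hsac, (hF z hc).1⟩, (hF z hc).2⟩, hac, hb⟩

theorem subset_sacClosure (I : Inst) (E : I.Var → Set I.Val) (hE : ∀ y, E y ⊆ I.dom y)
    (hsac : (I.withDom E).IsSAC) (x : I.Var) : E x ⊆ I.sacClosure.dom x :=
  fun _ ha => ⟨E, hE, hsac, ha⟩

/-- Deleting the constraint between `x` and `y`: it is replaced by the Cartesian product of the
two domains. -/
def deleteConstraint (I : Inst) (x y : I.Var) : Inst :=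
  { I with
    rel := fun u v a b =>
      (((u = x ∧ v = y) ∨ (u = y ∧ v = x)) → a ∈ I.dom u ∧ b ∈ I.dom v) ∧
      (¬ ((u = x ∧ v = y) ∨ (u = y ∧ v = x)) → I.rel u v a b)
    rel_symm := by
      intro u v a b huv
      have h := I.rel_symm u v a b huv
      tauto }

end Inst

/-! ## Patterns -/

/-- A pattern: finitely many points, each belonging to a variable, and a partial compatibility
function on the pairs of points of distinct variables, given by its positive and negative
edges. -/
structure Pattern where
  Var : Type
  Point : Type
  finite_var : Finite Var
  finite_point : Finite Point
  var : Point → Var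
  pos : Point → Point → Prop
  neg : Point → Point → Prop
  pos_symm : ∀ p q, pos p q → pos q p
  neg_symm : ∀ p q, neg p q → neg q p
  pos_var : ∀ p q, pos p q → var p ≠ var q
  neg_var : ∀ p q, neg p q → var p ≠ var q
  pos_neg : ∀ p q, pos p q → ¬ neg p q

/-- An instance regarded as a pattern whose compatibility function is total. -/
def Inst.toPattern (I : Inst) : Pattern where
  Var := I.Var
  Point := {p : I.Var × I.Val // p.2 ∈ I.dom p.1}
  finite_var := I.finite_var
  finite_point := by
    have := I.finite_var
    have := I.finite_val
    infer_instance
  var p := p.1.1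
  pos p q := p.1.1 ≠ q.1.1 ∧ I.rel p.1.1 q.1.1 p.1.2 q.1.2
  neg p q := p.1.1 ≠ q.1.1 ∧ ¬ I.rel p.1.1 q.1.1 p.1.2 q.1.2
  pos_symm p q h := ⟨h.1.symm, (I.rel_symm _ _ _ _ h.1).1 h.2⟩
  neg_symm p q h := ⟨h.1.symm, fun h' => h.2 ((I.rel_symm _ _ _ _ h.1).2 h')⟩
  pos_var p q h := h.1
  neg_var p q h := h.1
  pos_neg p q h h' := h'.2 h.2

namespace Pattern

/-- `P` occurs in `Q`: a map from the points of `P` to the points of `Q` that respects variables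
and sends positive edges to positive edges and negative edges to negative edges. -/
def OccursIn (P Q : Pattern) : Prop :=
  ∃ f : P.Point → Q.Point,
    (∀ p q, Q.var (f p) = Q.var (f q) ↔ P.var p = P.var q) ∧
    (∀ p q, P.pos p q → Q.pos (f p) (f q)) ∧
    (∀ p q, P.neg p q → Q.neg (f p) (f q))

/-- The class of binary CSP instances in which `P` does not occur. -/
def forbid (P : Pattern) : Set Inst := {I | ¬ P.OccursIn I.toPattern}

/-- `p` and `q` are mergeable: distinct points of the same variable, with no point that is
joined to one of them by a positive edge and to the other by a negative edge. -/
def Mergeable (P : Pattern) (p q : P.Point) : Prop :=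
  p ≠ q ∧ P.var p = P.var q ∧
    ¬ ∃ r, (P.pos p r ∧ P.neg q r) ∨ (P.neg p r ∧ P.pos q r)

/-- `p` is dangling: it is on at most one positive edge and on no negative edge. -/
def Dangling (P : Pattern) (p : P.Point) : Prop :=
  (∀ q q', P.pos p q → P.pos p q' → q = q') ∧ ∀ q, ¬ P.neg p q

def Irreducible (P : Pattern) : Prop :=
  (∀ p, ¬ P.Dangling p) ∧ ∀ p q, ¬ P.Mergeable p q

end Pattern

/-- A class of instances is monotone if it is closed under deleting constraints. -/
def MonotoneClass (C : Set Inst) : Prop :=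
  ∀ I ∈ C, ∀ x y : I.Var, x ≠ y → I.deleteConstraint x y ∈ C

namespace Pattern

/-- `P` is monotone if forbidding it defines a monotone class. -/
def IsMonotone (P : Pattern) : Prop := MonotoneClass P.forbid

/-- `P` is SAC-solvable if SAC decides every instance in which `P` does not occur. -/
def SACSolvable (P : Pattern) : Prop := ∀ I ∈ P.forbid, I.SACDecides

/-- The pattern with points `0, …, n - 1` on four variables, point `i` belonging to variable
`v i`, whose positive and negative edges are listed in `E` and `F` (each edge once). -/
def ofEdges (n : ℕ) (v : Fin n → Fin 4) (E F : List (Fin n × Fin n))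
    (hv : ∀ e ∈ E ++ F, v e.1 ≠ v e.2) (hd : ∀ e ∈ E, e ∉ F ∧ e.swap ∉ F) : Pattern where
  Var := Fin 4
  Point := Fin n
  finite_var := inferInstance
  finite_point := inferInstance
  var := v
  pos i j := (i, j) ∈ E ∨ (j, i) ∈ E
  neg i j := (i, j) ∈ F ∨ (j, i) ∈ F
  pos_symm _ _ h := h.symm
  neg_symm _ _ h := h.symm
  pos_var i j h := h.elim (fun h => hv (i, j) (List.mem_append_left _ h))
    (fun h => (hv (j, i) (List.mem_append_left _ h)).symm)
  neg_var i j h := h.elim (fun h => hv (i, j) (List.mem_append_right _ h))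
    (fun h => (hv (j, i) (List.mem_append_right _ h)).symm)
  pos_neg i j h h' := h.elim
    (fun h => h'.elim (hd (i, j) h).1 (hd (i, j) h).2)
    (fun h => h'.elim (hd (j, i) h).2 (hd (j, i) h).1)

end Pattern

/-! ## The twelve patterns

Each has the four variables `0, 1, 2, 3`, named `a, b, c, d` (`a, b, c, e` for Q1 and Q2); points
of one variable are numbered when there are several. -/

/-- The pattern Q1. Points 0, …, 5 are a, b1, b2, b3, c, e.
Negative edges a-b2, b3-c, b1-e; positive edges a-b3, b1-c, b2-e. -/
def patternQ1 : Pattern :=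
  Pattern.ofEdges 6 ![0, 1, 1, 1, 2, 3]
    [(0, 3), (1, 4), (2, 5)]
    [(0, 2), (3, 4), (1, 5)]
    (by decide) (by decide)

/-- The pattern Q2. Points 0, …, 4 are a, b1, b2, c, e.
Negative edges a-b2, b2-c, b1-e; positive edges a-b1, b2-e. -/
def patternQ2 : Pattern :=
  Pattern.ofEdges 5 ![0, 1, 1, 2, 3]
    [(0, 1), (2, 4)]
    [(0, 2), (2, 3), (1, 4)]
    (by decide) (by decide)

/-- The pattern R1. Points 0, …, 5 are a, b1, b2, c1, c2, d.
Negative edges a-b2, b2-c2, c1-d; positive edges a-b1, b2-c1, c2-d, b1-c1. -/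
def patternR1 : Pattern :=
  Pattern.ofEdges 6 ![0, 1, 1, 2, 2, 3]
    [(0, 1), (2, 3), (4, 5), (1, 3)]
    [(0, 2), (2, 4), (3, 5)]
    (by decide) (by decide)

/-- The pattern R2. Points 0, …, 6 are a1, a2, b1, b2, c1, c2, d.
Negative edges a2-b2, b2-c2, c1-d; positive edges a1-b2, b2-c1, c2-d, b1-c2, a1-b1. -/
def patternR2 : Pattern :=
  Pattern.ofEdges 7 ![0, 0, 1, 1, 2, 2, 3]
    [(0, 3), (3, 4), (5, 6), (2, 5), (0, 2)]
    [(1, 3), (3, 5), (4, 6)]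
    (by decide) (by decide)

/-- The pattern R3. Points 0, …, 5 are a, b, c1, c2, d1, d2.
Negative edges a-b, b-c2, c1-d1; positive edges b-c1, c1-d2, c2-d2. -/
def patternR3 : Pattern :=
  Pattern.ofEdges 6 ![0, 1, 2, 2, 3, 3]
    [(1, 2), (2, 5), (3, 5)]
    [(0, 1), (1, 3), (2, 4)]
    (by decide) (by decide)

/-- The pattern R4. Points 0, …, 5 are a, b1, b2, c1, c2, d.
Negative edges a-b2, b2-c2, c1-d; positive edges b1-c1, c2-d, b1-c2. -/
def patternR4 : Pattern :=
  Pattern.ofEdges 6 ![0, 1, 1, 2, 2, 3]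
    [(1, 3), (4, 5), (1, 4)]
    [(0, 2), (2, 4), (3, 5)]
    (by decide) (by decide)

/-- The pattern R5. Points 0, …, 5 are a, b1, b2, c1, c2, d.
Negative edges a-b2, b1-c1, c2-d; positive edges a-b1, b2-c1, c1-d, b1-c2. -/
def patternR5 : Pattern :=
  Pattern.ofEdges 6 ![0, 1, 1, 2, 2, 3]
    [(0, 1), (2, 3), (3, 5), (1, 4)]
    [(0, 2), (1, 3), (4, 5)]
    (by decide) (by decide)

/-- The pattern R6. Points 0, …, 6 are a1, a2, b1, b2, c1, c2, d.
Negative edges a2-b2, b1-c1, c2-d; positive edges a1-b2, b2-c1, c1-d, b1-c2, a1-b1. -/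
def patternR6 : Pattern :=
  Pattern.ofEdges 7 ![0, 0, 1, 1, 2, 2, 3]
    [(0, 3), (3, 4), (4, 6), (2, 5), (0, 2)]
    [(1, 3), (2, 4), (5, 6)]
    (by decide) (by decide)

/-- The pattern R7. Points 0, …, 6 are a, b1, b2, b3, c1, c2, d.
Negative edges a-b2, b1-c1, c2-d; positive edges a-b3, b3-c1, b2-c1, b1-c2, c1-d. -/
def patternR7 : Pattern :=
  Pattern.ofEdges 7 ![0, 1, 1, 1, 2, 2, 3]
    [(0, 3), (3, 4), (2, 4), (1, 5), (4, 6)]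
    [(0, 2), (1, 4), (5, 6)]
    (by decide) (by decide)

/-- The pattern R8. Points 0, …, 6 are a, b1, b2, b3, c1, c2, d.
Negative edges a-b2, b1-c1, c2-d; positive edges a-b3, a-b1, b3-c1, b1-c2, c1-d. -/
def patternR8 : Pattern :=
  Pattern.ofEdges 7 ![0, 1, 1, 1, 2, 2, 3]
    [(0, 3), (0, 1), (3, 4), (1, 5), (4, 6)]
    [(0, 2), (1, 4), (5, 6)]
    (by decide) (by decide)

/-- The pattern R9. Points 0, …, 6 are a, b1, b2, b3, c1, c2, d.
Negative edges a-b2, b1-c1, c2-d; positive edges a-b3, a-b1, b3-c1, b2-c2, c1-d. -/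
def patternR9 : Pattern :=
  Pattern.ofEdges 7 ![0, 1, 1, 1, 2, 2, 3]
    [(0, 3), (0, 1), (3, 4), (2, 5), (4, 6)]
    [(0, 2), (1, 4), (5, 6)]
    (by decide) (by decide)

/-- The pattern R10. Points 0, …, 5 are a, b1, b2, c1, c2, d.
Negative edges a-b2, b1-c1, c2-d; positive edges a-b1, b2-c2, c1-d, b1-c2. -/
def patternR10 : Pattern :=
  Pattern.ofEdges 6 ![0, 1, 1, 2, 2, 3]
    [(0, 1), (2, 4), (3, 5), (1, 4)]
    [(0, 2), (1, 3), (4, 5)]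
    (by decide) (by decide)

end BinCSP

/-!
A SAC-solvable pattern occurs in every unsatisfiable instance that is singleton arc consistent
(`SACSolvable.exists_occurrence`), so each such instance restricts the pattern by its own shape.
Five instances suffice.

* Three-colouring the complete graph on four vertices: at most four variables
  (`SACSolvable.exists_fin_four`).
* The same problem with each vertex split into a hub and copies joined to it by equality: a
  variable two of whose points are joined to one point by positive edges has few neighbors
  (`SACSolvable.hub_restrictions`).
* The pigeonhole principle with a Boolean cell for each pair of a pigeon and a hole: the graph of
  negative edges between variables is bipartite without cycles of length four, and on one side,
  that of the cells, a variable has at most two points, of which each point has at most one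
  support (`SACSolvable.exists_cells`).
* Three-colouring with subdivided conflicts: negative edges are never parallel, and on one side of
  the graph a variable has at most two points, each on at most one negative edge
  (`SACSolvable.exists_conflicts`).
* The pigeonhole principle with holes divided into two halves: no point has negative edges to
  three variables, and a variable with a point on two negative edges has no further interplay
  between these (`SACSolvable.half_restrictions`).

In a monotone pattern each positive edge is parallel to a negative one (`IsMonotone.linked`), since
a constraint of the pattern without negative edges could be created by a deletion. Hence the
negative edges determine which pairs of variables interact at all: an acyclic graph on at most four
vertices, that is a star, at most two disjoint edges, or a path (`SACSolvable.exists_numbering`).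

Irreducibility gives each point without negative edges two positive ones, and for two points of a
variable a third point that tells them apart. Together with the restrictions this leaves few
possibilities for the positive edges. A star occurs in Q1 or Q2 (`NegStar.occurs`). With disjoint
links there are no positive edges at all (`occurs_of_disjoint_links`). On a path with variables
`0`, `1`, `2`, `3`, it matters whether two negative edges have a common end: if so, the pattern
occurs in one of R1, …, R4, depending on which side of the bipartition the cells are
(`SharedPath.occurs_of_sec_even`, `SharedPath.occurs_of_sec_odd`); if not, the path can be
oriented so that the even variables are cells, unless it is short (`NegPath.occurs_of_short`), and
the pattern occurs in one of R5, …, R10 (`SplitPath.occurs`).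
-/

namespace BinCSP

/-! ### Occurrence in unsatisfiable SAC instances -/

/-- Subdomains that are arc consistent for the constraints `C u v a b ∧ C v u b a`. -/
def ArcConsistent {V A : Type} (C : V → V → A → A → Prop) (E : V → A → Prop) : Prop :=
  (∀ u, ∃ a, E u a) ∧ ∀ u a, E u a → ∀ v, v ≠ u → ∃ b, E v b ∧ C u v a b ∧ C v u b a

namespace Pattern

variable {P : Pattern}

/-- A SAC-solvable pattern occurs in every unsatisfiable SAC instance. The instance is given by
its domains and by a relation `C`, the constraint between `u` and `v` being
`C u v a b ∧ C v u b a`. That it is SAC is witnessed by a family `E` of arc consistent non-empty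
subdomains such that every value is the only one left to its variable by some member of the
family. The conclusion lists the variable and the value of the image of each point; the
occurrence is injective, because two points of an irreducible pattern that belong to the same
variable are told apart by a point joined to them by edges of different signs. -/
theorem SACSolvable.exists_occurrence (hP : P.SACSolvable) (hirr : P.Irreducible)
    {V A T : Type} [Finite V] [Finite A] (dom : V → A → Prop) (C : V → V → A → A → Prop)
    (E : T → V → A → Prop) (hEdom : ∀ t u a, E t u a → dom u a)
    (hE : ∀ t, ArcConsistent C (E t)) (hcover : ∀ u a, dom u a → ∃ t, ∀ b, E t u b → b = a)
    (hne : ∀ u, ∃ a, dom u a)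
    (hunsat : ∀ s : V → A, (∀ u, dom u (s u)) → ∃ u v, u ≠ v ∧ ¬ C u v (s u) (s v)) :
    ∃ (x : P.Point → V) (a : P.Point → A),
      (∀ p, dom (x p) (a p)) ∧
      (∀ p q, x p = x q ↔ P.var p = P.var q) ∧
      (∀ p q, P.pos p q → C (x p) (x q) (a p) (a q)) ∧
      (∀ p q, P.neg p q → ¬ C (x p) (x q) (a p) (a q) ∨ ¬ C (x q) (x p) (a q) (a p)) ∧
      (∀ p q, P.var p = P.var q → a p = a q → p = q) := by
  let I : Inst := ⟨V, A, inferInstance, inferInstance, fun u => {a | dom u a},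
    fun u v a b => C u v a b ∧ C v u b a, fun _ _ _ _ _ => and_comm⟩
  have hsac : I.IsSAC := by
    intro u a ha v
    obtain ⟨t, ht⟩ := hcover u a ha
    obtain ⟨b, hb⟩ := (hE t).1 v
    exact ⟨b, fun w => {c | E t w c}, fun w c hc => ⟨hEdom t w c hc, fun hw => ht c (hw ▸ hc)⟩,
      fun w c hc w' hw' => (hE t).2 w c hc w' hw', hb⟩
  have hocc : P.OccursIn I.toPattern := by
    by_contra h
    obtain ⟨s, hs, hs'⟩ := hP I h fun u =>
      let ⟨a, ha⟩ := hne u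
      ⟨a, I.subset_sacClosure I.dom (fun _ => subset_rfl) hsac u ha⟩
    obtain ⟨u, v, huv, h⟩ := hunsat s hs
    exact h (hs' u v huv).1
  obtain ⟨f, hvar, hpos, hneg⟩ := hocc
  refine ⟨fun p => (f p).1.1, fun p => (f p).1.2, fun p => (f p).2, hvar,
    fun p q hpq => (hpos p q hpq).2.1, fun p q hpq => not_and_or.1 (hneg p q hpq).2,
    fun p q hpq ha => ?_⟩
  have hf : f p = f q := Subtype.ext (Prod.ext ((hvar p q).2 hpq) ha)
  by_contra hne
  refine hirr.2 p q ⟨hne, hpq, ?_⟩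
  rintro ⟨r, ⟨h1, h2⟩ | ⟨h1, h2⟩⟩
  · exact I.toPattern.pos_neg _ _ (hpos p r h1) (hf ▸ hneg q r h2)
  · exact I.toPattern.pos_neg _ _ (hpos q r h2) (hf ▸ hneg p r h1)

end Pattern

/-! ### Three-colouring instances -/

/-- For colours `Fin 3` and variables grouped into classes, the subdomains `{a}` on the class `k`
and `{b | b ≠ a}` elsewhere are arc consistent, provided that every constraint accepts equal
colours within a class and different colours across classes. -/
theorem arcConsistent_of_classes {V K : Type} (cls : V → K) (C : V → V → Fin 3 → Fin 3 → Prop)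
    (hC : ∀ u v a b, u ≠ v → (a = b ↔ cls u = cls v) → C u v a b) (k : K) (a : Fin 3) :
    ArcConsistent C fun u b => b = a ↔ cls u = k := by
  have third : ∀ a b : Fin 3, ∃ c, c ≠ a ∧ b ≠ c := by decide
  have both : ∀ u v b c, v ≠ u → (b = c ↔ cls u = cls v) → C u v b c ∧ C v u c b :=
    fun u v b c huv h => ⟨hC u v b c huv.symm h, hC v u c b huv (by rw [eq_comm, h, eq_comm])⟩
  refine ⟨fun u => ?_, fun u b (hb : b = a ↔ cls u = k) v huv => ?_⟩
  · by_cases h : cls u = k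
    · exact ⟨a, by simp [h]⟩
    · obtain ⟨c, hc, -⟩ := third a a
      exact ⟨c, by simp [h, hc]⟩
  · by_cases h : cls u = cls v
    · exact ⟨b, hb.trans (by rw [h]), both _ _ _ _ huv (by simp [h])⟩
    · by_cases hv : cls v = k
      · exact ⟨a, by simp [hv], both _ _ _ _ huv (by rw [hb, hv])⟩
      · obtain ⟨c, hca, hbc⟩ := third a b
        exact ⟨c, by simp [hv, hca], both _ _ _ _ huv (by simp [h, hbc])⟩

/-- The constraints of the problem of three-colouring the complete graph on four vertices, with
several copies of each vertex: the copy `(i, i)` is the hub of the vertex `i`, joined by equality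
constraints to the copies `(i, j)` with `j ≠ i`, and the edge `ij` becomes the disequality
constraint between `(i, j)` and `(j, i)`. -/
def hubConstraint (u v : Fin 4 × Fin 4) (a b : Fin 3) : Prop :=
  (u.1 = v.1 ∧ (u.1 = u.2 ∨ v.1 = v.2) → a = b) ∧ (u.1 ≠ v.1 ∧ u.1 = v.2 ∧ u.2 = v.1 → a ≠ b)

namespace Pattern

variable {P : Pattern}

/-- Occurrence in the problem of three-colouring the complete graph on four vertices: there are
at most four variables, and at most three points in each. -/
theorem SACSolvable.exists_fin_four (hP : P.SACSolvable) (hirr : P.Irreducible) :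
    ∃ (x : P.Point → Fin 4) (a : P.Point → Fin 3), (∀ p q, x p = x q ↔ P.var p = P.var q) ∧
      ∀ p q, P.var p = P.var q → a p = a q → p = q := by
  obtain ⟨x, a, -, hx, -, -, ha⟩ := hP.exists_occurrence hirr (V := Fin 4) (A := Fin 3)
    (fun _ _ => True) (fun _ _ a b => a ≠ b) (T := Fin 4 × Fin 3) (fun t u b => b = t.2 ↔ u = t.1)
    (fun _ _ _ _ => trivial)
    (fun t => arcConsistent_of_classes id _ (fun u v a b huv h hab => huv (h.1 hab)) t.1 t.2)
    (fun u a _ => ⟨(u, a), fun b hb => hb.2 rfl⟩) (fun _ => ⟨0, trivial⟩)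
    (fun s _ => by
      obtain ⟨u, v, huv, h⟩ := Fintype.exists_ne_map_eq_of_card_lt s (by simp)
      exact ⟨u, v, huv, not_not.2 h⟩)
  exact ⟨x, a, hx, ha⟩

/-- Occurrence in the three-colouring problem in which each vertex is split into a hub and three
copies. -/
theorem SACSolvable.exists_hub (hP : P.SACSolvable) (hirr : P.Irreducible) :
    ∃ (x : P.Point → Fin 4 × Fin 4) (a : P.Point → Fin 3),
      (∀ p q, x p = x q ↔ P.var p = P.var q) ∧
      (∀ p q, P.pos p q → hubConstraint (x p) (x q) (a p) (a q)) ∧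
      (∀ p q, P.neg p q → ¬ hubConstraint (x p) (x q) (a p) (a q)) ∧
      ∀ p q, P.var p = P.var q → a p = a q → p = q := by
  have hsymm : ∀ u v a b, hubConstraint u v a b → hubConstraint v u b a := fun u v a b h =>
    ⟨fun h' => (h.1 ⟨h'.1.symm, h'.2.symm⟩).symm,
      fun h' => (h.2 ⟨h'.1.symm, h'.2.2.symm, h'.2.1.symm⟩).symm⟩
  obtain ⟨x, a, -, hx, hpos, hneg, ha⟩ := hP.exists_occurrence hirr
    (fun _ _ => True) hubConstraint (T := Fin 4 × Fin 3) (fun t u b => b = t.2 ↔ u.1 = t.1)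
    (fun _ _ _ _ => trivial)
    (fun t => arcConsistent_of_classes Prod.fst _
      (fun u v a b _ h => ⟨fun h' => h.2 h'.1, fun h' hab => h'.1 (h.1 hab)⟩) t.1 t.2)
    (fun u a _ => ⟨(u.1, a), fun b hb => hb.2 rfl⟩) (fun _ => ⟨0, trivial⟩)
    (fun s _ => by
      obtain ⟨i, j, hij, h⟩ := Fintype.exists_ne_map_eq_of_card_lt (fun i => s (i, i)) (by simp)
      by_contra! hs
      have h1 := (hs (i, i) (i, j) (by simp [hij])).1 ⟨rfl, Or.inl rfl⟩
      have h2 := (hs (j, j) (j, i) (by simp [hij.symm])).1 ⟨rfl, Or.inl rfl⟩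
      exact (hs (i, j) (j, i) (by simp [hij])).2 ⟨hij, rfl, rfl⟩ (h1 ▸ h2 ▸ h))
  exact ⟨x, a, hx, hpos, fun p q hpq => (hneg p q hpq).elim id fun h h' => h (hsymm _ _ _ _ h'),
    ha⟩

end Pattern

/-! ### Monotone patterns -/

namespace Pattern

variable {P : Pattern}

/-- Two variables are linked if some negative edge joins a point of one to a point of the other. -/
def Linked (P : Pattern) (x y : P.Var) : Prop := ∃ p q, P.var p = x ∧ P.var q = y ∧ P.neg p q

theorem Linked.symm {x y : P.Var} : P.Linked x y → P.Linked y x := fun ⟨p, q, hp, hq, h⟩ =>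
  ⟨q, p, hq, hp, P.neg_symm _ _ h⟩

/-- In a monotone pattern every positive edge is parallel to a negative one. Otherwise, regard
the pattern as an instance, all missing edges being negative, and replace the constraint between
the two variables by the empty relation; deleting that constraint makes the pattern occur, so it
occurs already before the deletion. But this occurrence permutes the pairs of variables
that carry positive edges while missing one of them. -/
theorem IsMonotone.linked (hP : P.IsMonotone) {p q : P.Point} (hpq : P.pos p q) :
    P.Linked (P.var p) (P.var q) := by
  by_contra hl
  have := P.finite_var
  have := P.finite_point
  let I : Inst := ⟨P.Var, P.Point, inferInstance, inferInstance, fun x => {r | P.var r = x},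
    fun u v a b => P.pos a b ∧
      ¬ ((u = P.var p ∧ v = P.var q) ∨ (u = P.var q ∧ v = P.var p)), fun u v a b _ => by
        rw [show P.pos a b ↔ P.pos b a from ⟨P.pos_symm _ _, P.pos_symm _ _⟩]
        tauto⟩
  have hdel : P.OccursIn (I.deleteConstraint (P.var p) (P.var q)).toPattern := by
    refine ⟨fun r => ⟨(P.var r, r), rfl⟩, fun _ _ => Iff.rfl, fun r s h =>
      ⟨P.pos_var _ _ h, fun _ => ⟨rfl, rfl⟩, fun h' => ⟨h, h'⟩⟩, fun r s h =>
      ⟨P.neg_var _ _ h, fun h' => ?_⟩⟩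
    by_cases hc : (P.var r = P.var p ∧ P.var s = P.var q) ∨ (P.var r = P.var q ∧ P.var s = P.var p)
    · rcases hc with hc | hc
      · exact hl ⟨r, s, hc.1, hc.2, h⟩
      · exact hl ⟨s, r, hc.2, hc.1, P.neg_symm _ _ h⟩
    · exact P.pos_neg _ _ (h'.2 hc).1 h
  have hocc : P.OccursIn I.toPattern := by
    by_contra h
    exact hP I h (P.var p) (P.var q) (P.pos_var _ _ hpq) hdel
  obtain ⟨f, hvar, hpos, -⟩ := hocc
  let S : Set (P.Var × P.Var) := {e | ∃ r s, P.pos r s ∧ P.var r = e.1 ∧ P.var s = e.2}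
  have hS : ∀ e : S, ∃ r s, P.pos r s ∧ P.var r = e.1.1 ∧ P.var s = e.1.2 := fun e => e.2
  choose r s hrs hr hs using hS
  have hfv : ∀ t, P.var (f t).1.2 = (f t).1.1 := fun t => (f t).2
  let φ : S → S := fun e => ⟨((f (r e)).1.1, (f (s e)).1.1), (f (r e)).1.2, (f (s e)).1.2,
    (hpos _ _ (hrs e)).2.1, hfv _, hfv _⟩
  have hφ : Function.Injective φ := by
    intro e e' h
    have h' := Subtype.ext_iff.1 h
    have h1 := (hvar _ _).1 (Prod.ext_iff.1 h').1
    have h2 := (hvar _ _).1 (Prod.ext_iff.1 h').2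
    exact Subtype.ext (Prod.ext (by rw [← hr, ← hr, h1]) (by rw [← hs, ← hs, h2]))
  obtain ⟨e, he⟩ := Finite.surjective_of_injective hφ ⟨(P.var p, P.var q), p, q, hpq, rfl, rfl⟩
  have he' := Prod.ext_iff.1 (Subtype.ext_iff.1 he)
  exact (hpos _ _ (hrs e)).2.2 (Or.inl he')

/-! ### Restrictions from the hub colouring -/

/-- If a point is joined by positive edges to two points of a variable, then the constraint between
these variables is a disequality in the hub colouring, since an equality leaves a single support.
So the second variable is sent to a copy that is not a hub: apart from the equality with its hub,
this disequality is its only constraint. -/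
theorem SACSolvable.hub_restrictions (hP : P.SACSolvable) (hirr : P.Irreducible)
    (hmono : P.IsMonotone) {p q q' : P.Point} (hq : P.pos p q) (hq' : P.pos p q') (hne : q ≠ q')
    (hv : P.var q = P.var q') :
    (∀ r s s', P.pos r s → P.pos r s' → s ≠ s' → P.var s = P.var q → P.var s' = P.var q →
      P.var r = P.var p) ∧
    ∀ y z w, P.Linked (P.var q) y → P.Linked (P.var q) z → P.Linked (P.var q) w →
      y = z ∨ y = w ∨ z = w := by
  obtain ⟨x, a, hx, hpos, hneg, ha⟩ := hP.exists_hub hirr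
  have key : ∀ r s s', P.pos r s → P.pos r s' → s ≠ s' → P.var s = P.var s' →
      x r = (x s).swap ∧ (x s).1 ≠ (x s).2 := by
    intro r s s' h h' hss' hvs
    obtain ⟨r₀, s₀, hr₀, hs₀, h₀⟩ := hmono.linked h
    have e1 := hpos _ _ h
    have e2 := hpos _ _ h'
    have e3 := hneg _ _ h₀
    rw [(hx _ _).2 hr₀, (hx _ _).2 hs₀] at e3
    rw [← (hx _ _).2 hvs] at e2
    have hneq : a s ≠ a s' := fun h => hss' (ha _ _ hvs h)
    simp only [hubConstraint] at e1 e2 e3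
    rw [Prod.ext_iff]
    simp only [Prod.fst_swap, Prod.snd_swap]
    grind
  have hnbr : ∀ y, P.Linked (P.var q) y → ∃ t, P.var t = y ∧
      (x t = (x q).swap ∨ x t = ((x q).1, (x q).1)) := by
    rintro y ⟨r, s, hr, rfl, h⟩
    have := hneg _ _ h
    rw [(hx _ _).2 hr] at this
    have h1 := (key p q q' hq hq' hne hv).2
    refine ⟨s, rfl, ?_⟩
    simp only [hubConstraint] at this
    simp only [Prod.ext_iff, Prod.fst_swap, Prod.snd_swap]
    grind
  refine ⟨fun r s s' h h' hss' hs hs' => ?_, fun y z w hy hz hw => ?_⟩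
  · rw [← hx, (key r s s' h h' hss' (hs.trans hs'.symm)).1, (key p q q' hq hq' hne hv).1,
      (hx _ _).2 hs]
  · obtain ⟨y, rfl, hy⟩ := hnbr y hy
    obtain ⟨z, rfl, hz⟩ := hnbr z hz
    obtain ⟨w, rfl, hw⟩ := hnbr w hw
    simp only [← hx]
    grind

end Pattern

/-! ### The pigeonhole instance with functional constraints -/

/-- The constraints of an encoding of the pigeonhole principle for the pigeons `inl (inl i)` and
the holes `inl (inr j)`: the Boolean cell `inr (i, j)` has the value `1` if and only if the pigeon
`i` chooses the hole `j`, that is the value `j.succ`, and if and only if the hole `j` chooses the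
pigeon `i`. -/
def cellConstraint : (Fin 4 ⊕ Fin 3) ⊕ (Fin 4 × Fin 3) → (Fin 4 ⊕ Fin 3) ⊕ (Fin 4 × Fin 3) →
    Fin 4 → Fin 4 → Prop
  | .inr (i, j), .inl (.inl i'), t, b => i' = i → (t = 1 ↔ b = j.succ)
  | .inr (i, j), .inl (.inr j'), t, b => j' = j → (t = 1 ↔ b = i)
  | _, _, _, _ => True

/-- The domains: pigeons choose a non-zero value, cells are Boolean. -/
def cellDomain : (Fin 4 ⊕ Fin 3) ⊕ (Fin 4 × Fin 3) → Fin 4 → Prop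
  | .inl (.inl _), a => a ≠ 0
  | .inl (.inr _), _ => True
  | .inr _, t => t = 0 ∨ t = 1

/-- The subdomains that remain when the pigeon `i` and the hole `j` choose each other. -/
def cellSubdomain (i : Fin 4) (j : Fin 3) : (Fin 4 ⊕ Fin 3) ⊕ (Fin 4 × Fin 3) → Fin 4 → Prop
  | .inl (.inl i'), a => a ≠ 0 ∧ (a = j.succ ↔ i' = i)
  | .inl (.inr j'), b => b = i ↔ j' = j
  | .inr (i', j'), t => (t = 0 ∨ t = 1) ∧ (i' = i ∧ j' = j → t = 1) ∧ (¬ (i' = i ↔ j' = j) → t = 0)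

theorem arcConsistent_cellSubdomain (i : Fin 4) (j : Fin 3) :
    ArcConsistent cellConstraint (cellSubdomain i j) := by
  constructor
  · rintro ((i' | j') | ⟨i', j'⟩) <;> simp only [cellSubdomain] <;> decide +kernel +revert
  · rintro ((i' | j') | ⟨i', j'⟩) a ha ((i'' | j'') | ⟨i'', j''⟩) - <;> revert ha <;>
      simp only [cellSubdomain, cellConstraint, and_true, true_and] <;> decide +kernel +revert

namespace Pattern

variable {P : Pattern}

/-- Occurrence in the pigeonhole instance with functional constraints. The variables in `Z`, sent
to cells, have at most two points; every other point is joined by a positive edge to at most one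
of them, since its value determines that of the cell. A cell is determined by its two
neighbours, so there is no cycle of length four. -/
theorem SACSolvable.exists_cells (hP : P.SACSolvable) (hirr : P.Irreducible)
    (hmono : P.IsMonotone) : ∃ Z : P.Var → Prop,
    (∀ x y, P.Linked x y → (Z x ↔ ¬ Z y)) ∧
    (∀ p q r, Z (P.var p) → P.var p = P.var q → P.var p = P.var r → p = q ∨ p = r ∨ q = r) ∧
    (∀ p q r, Z (P.var p) → P.var p = P.var q → P.pos p r → P.pos q r → p = q) ∧
    ∀ x y z w, P.Linked x y → P.Linked y z → P.Linked z w → P.Linked w x → x ≠ z → y ≠ w →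
      False := by
  obtain ⟨x, a, hdom, hx, hpos, hneg, ha⟩ := hP.exists_occurrence hirr cellDomain cellConstraint
    (T := Fin 4 × Fin 3) (fun t => cellSubdomain t.1 t.2)
    (by
      rintro t ((i' | j') | ⟨i', j'⟩) a h
      exacts [h.1, trivial, h.1])
    (fun t => arcConsistent_cellSubdomain t.1 t.2)
    (by
      rintro ((i' | j') | ⟨i', j'⟩) a h <;> simp only [cellDomain] at h <;> revert h <;>
        simp only [cellSubdomain] <;> decide +kernel +revert)
    (by
      rintro ((i' | j') | ⟨i', j'⟩)
      exacts [⟨1, by simp [cellDomain]⟩, ⟨0, trivial⟩, ⟨0, Or.inl rfl⟩])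
    (by
      intro s hs
      by_contra! hc
      have hp : ∀ i, ∃ j, s (.inl (.inl i)) = Fin.succ j := fun i =>
        (Fin.exists_succ_eq.2 (hs (.inl (.inl i)))).imp fun _ h => h.symm
      choose g hg using hp
      have hh : ∀ i, s (.inl (.inr (g i))) = i := fun i =>
        (hc (.inr (i, g i)) (.inl (.inr (g i))) (by simp) rfl).1
          ((hc (.inr (i, g i)) (.inl (.inl i)) (by simp) rfl).2 (hg i))
      obtain ⟨i, i', hii', h⟩ := Fintype.exists_ne_map_eq_of_card_lt g (by simp)
      exact hii' (by rw [← hh i, ← hh i', h]))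
  -- Each link joins a cell to its pigeon or to its hole.
  have hlink : ∀ p q, P.Linked (P.var p) (P.var q) → ∃ i j,
      (x p = .inr (i, j) ∧ (x q = .inl (.inl i) ∨ x q = .inl (.inr j))) ∨
      (x q = .inr (i, j) ∧ (x p = .inl (.inl i) ∨ x p = .inl (.inr j))) := by
    rintro p q ⟨r, s, hr, hs, h⟩
    have h' := hneg _ _ h
    rw [(hx _ _).2 hr, (hx _ _).2 hs] at h'
    generalize x p = u at h' ⊢
    generalize x q = v at h' ⊢
    rcases u with ((i | j) | ⟨i, j⟩) <;> rcases v with ((i' | j') | ⟨i', j'⟩) <;>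
      simp [cellConstraint] at h' ⊢ <;> tauto
  have hex : ∀ {x y}, P.Linked x y → ∃ p q, P.var p = x ∧ P.var q = y := fun ⟨p, q, hp, hq, _⟩ =>
    ⟨p, q, hp, hq⟩
  have hZ : ∀ p, (∃ q, P.var q = P.var p ∧ ∃ c, x q = .inr c) ↔ ∃ c, x p = .inr c := fun p =>
    ⟨fun ⟨q, hq, h⟩ => (hx _ _).2 hq ▸ h, fun h => ⟨p, rfl, h⟩⟩
  refine ⟨fun y => ∃ q, P.var q = y ∧ ∃ c, x q = .inr c, ?_, ?_, ?_, ?_⟩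
  · intro y z h
    obtain ⟨p, q, rfl, rfl⟩ := hex h
    beta_reduce
    rw [hZ, hZ]
    obtain ⟨i, j, ⟨h1, h2 | h2⟩ | ⟨h1, h2 | h2⟩⟩ := hlink p q h <;> simp [h1, h2]
  · intro p q r h hq hr
    obtain ⟨c, hc⟩ := (hZ p).1 h
    have h1 := hdom p
    have h2 := hdom q
    have h3 := hdom r
    rw [← (hx _ _).2 hq] at h2
    rw [← (hx _ _).2 hr] at h3
    simp only [hc, cellDomain] at h1 h2 h3
    have hqr : a p = a q ∨ a p = a r ∨ a q = a r := by grind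
    exact hqr.imp (ha _ _ hq) (Or.imp (ha _ _ hr) (ha _ _ (hq.symm.trans hr)))
  · intro p q r h hq h1 h2
    obtain ⟨c, hc⟩ := (hZ p).1 h
    apply ha _ _ hq
    have hl := hlink p r (hmono.linked h1)
    have d1 := hdom p
    have d2 := hdom q
    have e1 := hpos _ _ h1
    have e2 := hpos _ _ h2
    rw [← (hx _ _).2 hq] at d2 e2
    obtain ⟨i, j, ⟨h3, h4 | h4⟩ | ⟨h3, h4 | h4⟩⟩ := hl <;>
      simp only [h3, h4, cellDomain, cellConstraint, forall_const] at d1 d2 e1 e2 <;> grind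
  · intro x₁ x₂ x₃ x₄ h12 h23 h34 h41 h13 h24
    obtain ⟨p₁, p₂, rfl, rfl⟩ := hex h12
    obtain ⟨p₃, p₄, rfl, rfl⟩ := hex h34
    rw [ne_eq, ← hx] at h13 h24
    obtain ⟨i, j, h1⟩ := hlink _ _ h12
    obtain ⟨i', j', h2⟩ := hlink _ _ h23
    obtain ⟨i'', j'', h3⟩ := hlink _ _ h34
    obtain ⟨i''', j''', h4⟩ := hlink _ _ h41
    grind

end Pattern

/-! ### Three-colouring with subdivided conflicts -/

/-- The constraints of the problem of three-colouring the complete graph on four vertices in which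
every conflict is subdivided: for `i < j` the Boolean variable `inr (i, j, c)` has the value `1`
if `i` has the colour `c`, and the value `0` if `j` has the colour `c`. -/
def conflictConstraint : Fin 4 ⊕ (Fin 4 × Fin 4 × Fin 3) → Fin 4 ⊕ (Fin 4 × Fin 4 × Fin 3) →
    Fin 3 → Fin 3 → Prop
  | .inl k, .inr (i, j, c), a, t => i < j → a = c → (k = i → t = 1) ∧ (k = j → t = 0)
  | _, _, _, _ => True

/-- The domains; the variables `inr (i, j, c)` with `i ≥ j` serve no purpose and have one value. -/
def conflictDomain : Fin 4 ⊕ (Fin 4 × Fin 4 × Fin 3) → Fin 3 → Prop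
  | .inl _, _ => True
  | .inr (i, j, _), t => t = 0 ∨ (t = 1 ∧ i < j)

/-- The subdomains that remain when the vertex `k` has the colour `a`. -/
def conflictSubdomain (k : Fin 4) (a : Fin 3) : Fin 4 ⊕ (Fin 4 × Fin 4 × Fin 3) → Fin 3 → Prop
  | .inl i, b => b = a ↔ i = k
  | .inr (i, j, c), t => (t = 0 ∨ (t = 1 ∧ i < j)) ∧
      (i < j → c = a → (i = k → t = 1) ∧ (j = k → t = 0))

set_option synthInstance.maxSize 1000 in
set_option synthInstance.maxHeartbeats 200000 in
theorem arcConsistent_conflictSubdomain (k : Fin 4) (a : Fin 3) :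
    ArcConsistent conflictConstraint (conflictSubdomain k a) := by
  constructor
  · rintro (i | ⟨i, j, c⟩) <;> simp only [conflictSubdomain] <;> decide +kernel +revert
  · rintro (i | ⟨i, j, c⟩) b hb (i' | ⟨i', j', c'⟩) hne <;> revert hb hne <;>
      simp only [conflictSubdomain, conflictConstraint, and_true, true_and, ne_eq, reduceCtorEq,
        not_false_eq_true, forall_const]
    · intro hb hne
      by_cases h : i' = k
      · exact ⟨a, by simp [h]⟩
      · obtain ⟨c, hc⟩ : ∃ c : Fin 3, c ≠ a := exists_ne a
        exact ⟨c, by simp [h, hc]⟩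
    · decide +kernel +revert
    · decide +kernel +revert
    · intro hb hne
      clear hb hne b c i j
      decide +kernel +revert

namespace Pattern

variable {P : Pattern}

/-- Occurrence in the three-colouring problem with subdivided conflicts. Negative edges are never
parallel. The variables in `Z`, sent to conflicts, have at most two points, each on at most
one negative edge. -/
theorem SACSolvable.exists_conflicts (hP : P.SACSolvable) (hirr : P.Irreducible) :
    (∀ p q p' q', P.neg p q → P.neg p' q' → P.var p = P.var p' → P.var q = P.var q' → p = p') ∧
    ∃ Z : P.Var → Prop, (∀ x y, P.Linked x y → (Z x ↔ ¬ Z y)) ∧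
    (∀ p q r, Z (P.var p) → P.var p = P.var q → P.var p = P.var r → p = q ∨ p = r ∨ q = r) ∧
    ∀ p q r, Z (P.var p) → P.neg p q → P.neg p r → q = r := by
  obtain ⟨x, a, hdom, hx, -, hneg, ha⟩ := hP.exists_occurrence hirr conflictDomain
    conflictConstraint (T := Fin 4 × Fin 3) (fun t => conflictSubdomain t.1 t.2)
    (by
      rintro t (i | ⟨i, j, c⟩) b h
      exacts [trivial, h.1])
    (fun t => arcConsistent_conflictSubdomain t.1 t.2)
    (by
      rintro (i | ⟨i, j, c⟩) b h
      · exact ⟨(i, b), fun b' hb' => hb'.2 rfl⟩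
      · by_cases hb : b = 1
        · refine ⟨(i, c), fun t ht => ?_⟩
          simp only [conflictSubdomain, conflictDomain] at ht h
          grind
        · refine ⟨(j, c), fun t ht => ?_⟩
          simp only [conflictSubdomain, conflictDomain] at ht h
          grind)
    (by
      rintro (i | ⟨i, j, c⟩)
      exacts [⟨0, trivial⟩, ⟨0, Or.inl rfl⟩])
    (by
      intro s hs
      by_contra! hc
      obtain ⟨i, j, hij, h⟩ :=
        Fintype.exists_ne_map_eq_of_card_lt (fun i => s (.inl i)) (by simp)
      wlog hlt : i < j generalizing i j
      · exact this j i hij.symm h.symm (by omega)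
      have h1 := (hc (.inl i) (.inr (i, j, s (.inl i))) (by simp) hlt rfl).1 rfl
      have h2 := (hc (.inl j) (.inr (i, j, s (.inl i))) (by simp) hlt h.symm).2 rfl
      rw [h1] at h2
      exact absurd h2 (by decide))
  -- A negative edge joins a conflict to one of its two vertices; the value on either side
  -- is determined by the other.
  have hedge : ∀ p q, P.neg p q → ∃ i j c, i < j ∧
      ((x p = .inr (i, j, c) ∧ a q = c ∧ (x q = .inl i ∧ a p = 0 ∨ x q = .inl j ∧ a p = 1)) ∨
      (x q = .inr (i, j, c) ∧ a p = c ∧ (x p = .inl i ∧ a q = 0 ∨ x p = .inl j ∧ a q = 1))) := by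
    intro p q h
    have h' := hneg _ _ h
    have hp := hdom p
    have hq := hdom q
    generalize x p = u at h' hp ⊢
    generalize x q = v at h' hq ⊢
    rcases u with (k | ⟨i, j, c⟩) <;> rcases v with (k' | ⟨i', j', c'⟩) <;>
      simp [conflictConstraint, conflictDomain] at h' hp hq ⊢
    · grind
    · grind
  have hZ : ∀ p, (∃ q, P.var q = P.var p ∧ ∃ c, x q = .inr c) ↔ ∃ c, x p = .inr c := fun p =>
    ⟨fun ⟨q, hq, h⟩ => (hx _ _).2 hq ▸ h, fun h => ⟨p, rfl, h⟩⟩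
  refine ⟨fun p q p' q' h h' hp hq => ?_, fun y => ∃ q, P.var q = y ∧ ∃ c, x q = .inr c, ?_, ?_, ?_⟩
  · apply ha _ _ hp
    rw [← hx] at hp hq
    obtain ⟨i, j, c, hij, h⟩ := hedge _ _ h
    obtain ⟨i', j', c', hij', h'⟩ := hedge _ _ h'
    grind
  · rintro y z ⟨p, q, rfl, rfl, h⟩
    beta_reduce
    rw [hZ, hZ]
    obtain ⟨i, j, c, -, ⟨h1, -, h2 | h2⟩ | ⟨h1, -, h2 | h2⟩⟩ := hedge p q h <;> simp [h1, h2]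
  · intro p q r h hq hr
    obtain ⟨c, hc⟩ := (hZ p).1 h
    have h1 := hdom p
    have h2 := hdom q
    have h3 := hdom r
    rw [← (hx _ _).2 hq] at h2
    rw [← (hx _ _).2 hr] at h3
    simp only [hc, conflictDomain] at h1 h2 h3
    have hqr : a p = a q ∨ a p = a r ∨ a q = a r := by grind
    exact hqr.imp (ha _ _ hq) (Or.imp (ha _ _ hr) (ha _ _ (hq.symm.trans hr)))
  · intro p q r h hq hr
    obtain ⟨c, hc⟩ := (hZ p).1 h
    obtain ⟨i, j, c, hij, h⟩ := hedge _ _ hq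
    obtain ⟨i', j', c', hij', h'⟩ := hedge _ _ hr
    have hqr : x q = x r ∧ a q = a r := by grind
    exact ha _ _ ((hx _ _).1 hqr.1) hqr.2

end Pattern

/-! ### The pigeonhole instance with split holes -/

/-- The constraints of an encoding of the pigeonhole principle for the four pigeons `inl (s, t)`
and the three holes. The half `inr (j, s)` of the hole `j` is reserved to the pigeons `(s, t)`;
its value is `0` or `1` for the pigeon with `t = false` or `t = true`, and `2` for none of them.
At most one of the two halves of a hole is in use. -/
def halfConstraint : (Bool × Bool) ⊕ (Fin 3 × Bool) → (Bool × Bool) ⊕ (Fin 3 × Bool) →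
    Fin 3 → Fin 3 → Prop
  | .inl (s, t), .inr (j, s'), a, u => s' = s → a = j → u = cond t 1 0
  | .inr (j, s), .inr (j', s'), u, u' => j = j' → s ≠ s' → u = 2 ∨ u' = 2
  | _, _, _, _ => True

/-- The subdomains that remain when the pigeon `(s, t)` is in the hole `j`. -/
def halfSubdomain (s t : Bool) (j : Fin 3) : (Bool × Bool) ⊕ (Fin 3 × Bool) → Fin 3 → Prop
  | .inl (s', t'), a => a = j ↔ s' = s ∧ t' = t
  | .inr (j', s'), u => j' = j → (s' = s → u = cond t 1 0) ∧ (s' ≠ s → u = 2)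

set_option synthInstance.maxSize 1000 in
set_option synthInstance.maxHeartbeats 200000 in
theorem arcConsistent_halfSubdomain (s t : Bool) (j : Fin 3) :
    ArcConsistent halfConstraint (halfSubdomain s t j) := by
  constructor
  · rintro (⟨s', t'⟩ | ⟨j', s'⟩) <;> simp only [halfSubdomain] <;> decide +kernel +revert
  · rintro (⟨s', t'⟩ | ⟨j', s'⟩) a ha (⟨s'', t''⟩ | ⟨j'', s''⟩) - <;> revert ha <;>
      simp only [halfSubdomain, halfConstraint, and_true, true_and] <;> decide +kernel +revert

namespace Pattern

variable {P : Pattern}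

/-- Occurrence in the pigeonhole instance with split holes. No point has negative edges to three
variables. If some point of a variable has negative edges to two variables, then that variable is
sent to half of a hole, whose three neighbours support pairwise distinct values; so
none of its points supports the ends `u` and `w`, in different variables, of two negative edges at
that variable. -/
theorem SACSolvable.half_restrictions (hP : P.SACSolvable) (hirr : P.Irreducible) :
    (∀ p q r s, P.neg p q → P.neg p r → P.neg p s →
      P.var q = P.var r ∨ P.var q = P.var s ∨ P.var r = P.var s) ∧
    ∀ b a c, P.neg b a → P.neg b c → P.var a ≠ P.var c →
      ∀ b' b₁ b₂ u w, P.var b' = P.var b → P.var b₁ = P.var b → P.var b₂ = P.var b →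
        P.neg b₁ u → P.neg b₂ w → P.pos b' u → P.pos b' w → P.var u = P.var w := by
  obtain ⟨x, a, -, hx, hpos, hneg, ha⟩ := hP.exists_occurrence hirr (fun _ _ => True)
    halfConstraint (T := Bool × Bool × Fin 3) (fun t => halfSubdomain t.1 t.2.1 t.2.2)
    (fun _ _ _ _ => trivial) (fun t => arcConsistent_halfSubdomain t.1 t.2.1 t.2.2)
    (by
      rintro (⟨s, t⟩ | ⟨j, s⟩) b - <;> simp only [halfSubdomain] <;> decide +kernel +revert)
    (fun _ => ⟨0, trivial⟩)
    (by
      intro s _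
      by_contra! hc
      obtain ⟨⟨i, t⟩, ⟨i', t'⟩, hne, h⟩ :=
        Fintype.exists_ne_map_eq_of_card_lt (fun i => s (.inl i)) (by simp)
      have h1 := hc (.inl (i, t)) (.inr (s (.inl (i, t)), i)) (by simp) rfl rfl
      have h2 := hc (.inl (i', t')) (.inr (s (.inl (i, t)), i')) (by simp) rfl h.symm
      have h3 := hc (.inr (s (.inl (i, t)), i)) (.inr (s (.inl (i, t)), i'))
      simp only [halfConstraint, h1, h2] at h3
      have hii : i = i' := by
        by_contra hii
        exact absurd (h3 (by simpa using hii) trivial hii) (by clear h1 h2 h3 h; decide +revert)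
      subst hii
      refine hne (congrArg _ ?_)
      rw [h1] at h2
      revert h2
      clear h1 h h3 hne
      cases t <;> cases t' <;> decide)
  have hedge : ∀ p q, P.neg p q → ∃ j s,
      (∃ t, x p = .inl (s, t) ∧ x q = .inr (j, s) ∧ a p = j ∧ a q ≠ cond t 1 0) ∨
      (∃ t, x q = .inl (s, t) ∧ x p = .inr (j, s) ∧ a q = j ∧ a p ≠ cond t 1 0) ∨
      (x p = .inr (j, s) ∧ x q = .inr (j, !s) ∧ a p ≠ 2 ∧ a q ≠ 2) := by
    intro p q h
    have h' := hneg _ _ h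
    generalize x p = u at h' ⊢
    generalize x q = v at h' ⊢
    rcases u with (⟨s, t⟩ | ⟨j, s⟩) <;> rcases v with (⟨s', t'⟩ | ⟨j', s'⟩) <;>
      simp only [halfConstraint, not_true_eq_false, or_self, or_false, false_or, not_forall,
        exists_prop] at h'
    · obtain ⟨rfl, rfl, h'⟩ := h'
      exact ⟨_, _, .inl ⟨t, rfl, rfl, rfl, h'⟩⟩
    · obtain ⟨rfl, rfl, h'⟩ := h'
      exact ⟨_, _, .inr (.inl ⟨t', rfl, rfl, rfl, h'⟩)⟩
    · have h'' : j = j' ∧ s ≠ s' ∧ a p ≠ 2 ∧ a q ≠ 2 := by tauto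
      obtain ⟨rfl, hs, hp, hq⟩ := h''
      refine ⟨j, s, .inr (.inr ⟨rfl, ?_, hp, hq⟩)⟩
      rw [Bool.eq_not.2 hs.symm]
  refine ⟨fun p q r s hq hr hs => ?_,
    fun b u v hu hv huv b' b₁ b₂ w₁ w₂ hb' hb₁ hb₂ h₁ h₂ p₁ p₂ => ?_⟩
  · simp only [← hx]
    rcases hp : x p with ⟨s, t⟩ | ⟨j, s⟩
    · obtain ⟨j', s', h1⟩ := hedge _ _ hq
      obtain ⟨j'', s'', h2⟩ := hedge _ _ hr
      grind
    · have key : ∀ w, P.neg p w →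
          (∃ t, x w = .inl (s, t) ∧ a p ≠ cond t 1 0) ∨ (x w = .inr (j, !s) ∧ a p ≠ 2) := by
        intro w hw
        obtain ⟨j', s', h1⟩ := hedge _ _ hw
        grind
      have hcases : a p = 0 ∨ a p = 1 ∨ a p = 2 := by generalize a p = c; decide +revert
      rcases key _ hq with ⟨t₁, h1, h1'⟩ | ⟨h1, h1'⟩ <;>
        rcases key _ hr with ⟨t₂, h2, h2'⟩ | ⟨h2, h2'⟩ <;>
        rcases key _ hs with ⟨t₃, h3, h3'⟩ | ⟨h3, h3'⟩ <;> rw [h1, h2, h3] <;> grind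
  · rw [ne_eq, ← hx] at huv
    rw [← hx] at hb' hb₁ hb₂ ⊢
    obtain ⟨j, s, hb⟩ : ∃ j s, x b = .inr (j, s) := by
      obtain ⟨j, s, hu⟩ := hedge _ _ hu
      obtain ⟨j', s', hv⟩ := hedge _ _ hv
      grind
    have key : ∀ b₁ w, x b₁ = x b → P.neg b₁ w → P.pos b' w →
        (∃ t, x w = .inl (s, t) ∧ a b' = cond t 1 0) ∨ (x w = .inr (j, !s) ∧ a b' = 2) := by
      intro b₁ w hb₁ hn hp
      obtain ⟨j', s', hn⟩ := hedge _ _ hn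
      have h1 := hpos _ _ hp
      have h2 := hpos _ _ (P.pos_symm _ _ hp)
      rw [hb'] at h1 h2
      rw [hb₁] at hn
      rcases hn with ⟨t, h3, -⟩ | ⟨t, h3, h4, h5, -⟩ | ⟨h3, h4, -, h5⟩ <;> rw [hb] at *
      · exact absurd h3 (by simp)
      · obtain ⟨rfl, rfl⟩ : j = j' ∧ s = s' := by simpa using h4
        rw [h3] at h1 h2 ⊢
        exact Or.inl ⟨t, rfl, h2 rfl h5⟩
      · obtain ⟨rfl, rfl⟩ : j = j' ∧ s = s' := by simpa using h3
        rw [h4] at h1 h2 ⊢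
        exact Or.inr ⟨rfl, (h1 rfl (by simp)).resolve_right h5⟩
    rcases key _ _ hb₁ h₁ p₁ with ⟨t, h3, h4⟩ | ⟨h3, h4⟩ <;>
      rcases key _ _ hb₂ h₂ p₂ with ⟨t', h5, h6⟩ | ⟨h5, h6⟩ <;> rw [h3, h5] <;>
      rw [h4] at h6 <;> clear * - h6 <;> revert h6
    · cases t <;> cases t' <;> simp
    · cases t <;> simp
    · cases t' <;> simp

end Pattern

/-! ### The shape of the negative edges -/

set_option synthInstance.maxSize 1000 in
set_option synthInstance.maxHeartbeats 200000 in
/-- A graph on four vertices without cycles is a star, or has at most two disjoint edges,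
or is a path with two or three edges. -/
theorem exists_perm_of_acyclic (G : Fin 4 → Fin 4 → Prop) (hsymm : ∀ i j, G i j → G j i)
    (h3 : ∀ i j k, G i j → G j k → ¬ G k i)
    (h4 : ∀ i j k l, i ≠ k → j ≠ l → G i j → G j k → G k l → ¬ G l i) :
    ∃ e : Equiv.Perm (Fin 4),
      (G (e 1) (e 0) ∧ G (e 1) (e 2) ∧ G (e 1) (e 3)) ∨
      (¬ G (e 1) (e 2) ∧ ¬ G (e 0) (e 2) ∧ ¬ G (e 0) (e 3) ∧ ¬ G (e 1) (e 3)) ∨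
      (G (e 0) (e 1) ∧ G (e 1) (e 2) ∧ ¬ G (e 0) (e 2) ∧ ¬ G (e 0) (e 3) ∧ ¬ G (e 1) (e 3)) := by
  -- Symmetric Boolean matrices without loops, given by their six entries above the diagonal.
  have key : ∀ a b c d e f : Bool, ∀ M : Fin 4 → Fin 4 → Bool,
      M = ![![false, a, b, c], ![a, false, d, e], ![b, d, false, f], ![c, e, f, false]] →
      (∀ i j k, M i j → M j k → ¬ M k i) →
      (∀ i j k l, i ≠ k → j ≠ l → M i j → M j k → M k l → ¬ M l i) →
      ∃ i j k l : Fin 4, (i ≠ j ∧ i ≠ k ∧ i ≠ l ∧ j ≠ k ∧ j ≠ l ∧ k ≠ l) ∧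
        ((M j i ∧ M j k ∧ M j l) ∨ (¬ M j k ∧ ¬ M i k ∧ ¬ M i l ∧ ¬ M j l) ∨
        (M i j ∧ M j k ∧ ¬ M i k ∧ ¬ M i l ∧ ¬ M j l)) := by
    intro a b c d e f M hM
    subst hM
    revert a b c d e f
    decide +kernel
  classical
  have hG : ∀ i j, (fun i j => decide (G i j)) i j ↔ G i j := fun i j => by simp
  obtain ⟨i, j, k, l, hne, h⟩ := key (G 0 1) (G 0 2) (G 0 3) (G 1 2) (G 1 3) (G 2 3)
    (fun i j => decide (G i j)) (by
      have hirr : ∀ i, ¬ G i i := fun i h => h3 i i i h h h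
      have hcomm : ∀ i j, G i j ↔ G j i := fun i j => ⟨hsymm i j, hsymm j i⟩
      ext i j
      fin_cases i <;> fin_cases j <;> simp [hirr] <;> exact hcomm _ _)
    (by simpa only [hG] using h3) (by simpa only [hG] using h4)
  simp only [hG] at h
  have hinj : Function.Injective ![i, j, k, l] := by
    intro x y
    fin_cases x <;> fin_cases y <;> simp <;> grind
  exact ⟨Equiv.ofBijective _ (Finite.injective_iff_bijective.1 hinj), h⟩

namespace Pattern

variable {P : Pattern}

/-- The variables of a SAC-solvable pattern can be numbered so that the pairs of linked variables
form a star with center `1`, or are among `01` and `23`, or form a path `0123` or `012`. -/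
theorem SACSolvable.exists_numbering (hP : P.SACSolvable) (hirr : P.Irreducible)
    (hmono : P.IsMonotone) : ∃ v : P.Point → Fin 4, (∀ p q, v p = v q ↔ P.var p = P.var q) ∧
      ((∃ p q r p' q' r', (v p = 1 ∧ v q = 1 ∧ v r = 1 ∧ v p' = 0 ∧ v q' = 2 ∧ v r' = 3) ∧
        P.neg p p' ∧ P.neg q q' ∧ P.neg r r') ∨
      (∀ p q, P.neg p q → v p < v q → (v p = 0 ∧ v q = 1) ∨ (v p = 2 ∧ v q = 3)) ∨
      ((∃ p q r s, (v p = 0 ∧ v q = 1 ∧ v r = 1 ∧ v s = 2) ∧ P.neg p q ∧ P.neg r s) ∧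
        ∀ p q, P.neg p q → v p < v q →
          (v p = 0 ∧ v q = 1) ∨ (v p = 1 ∧ v q = 2) ∨ (v p = 2 ∧ v q = 3))) := by
  obtain ⟨x, -, hx, -⟩ := hP.exists_fin_four hirr
  obtain ⟨Z, hZ, -, -, h4⟩ := hP.exists_cells hirr hmono
  let G : Fin 4 → Fin 4 → Prop := fun i j => ∃ p q, P.neg p q ∧ x p = i ∧ x q = j
  have hG : ∀ p q, G (x p) (x q) → P.Linked (P.var p) (P.var q) := fun p q ⟨r, s, h, hr, hs⟩ =>
    ⟨r, s, (hx _ _).1 hr, (hx _ _).1 hs, h⟩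
  have hex : ∀ i j, G i j → ∃ p q, x p = i ∧ x q = j := fun i j ⟨p, q, _, hp, hq⟩ =>
    ⟨p, q, hp, hq⟩
  obtain ⟨e, he⟩ := exists_perm_of_acyclic G
    (fun i j ⟨p, q, h, hp, hq⟩ => ⟨q, p, P.neg_symm _ _ h, hq, hp⟩)
    (fun i j k h1 h2 h3 => by
      obtain ⟨p, q, rfl, rfl⟩ := hex _ _ h1
      obtain ⟨-, r, -, rfl⟩ := hex _ _ h2
      have := hZ _ _ (hG _ _ h1)
      have := hZ _ _ (hG _ _ h2)
      have := hZ _ _ (hG _ _ h3)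
      tauto)
    (fun i j k l hik hjl h12 h23 h34 h41 => by
      obtain ⟨p, q, rfl, rfl⟩ := hex _ _ h12
      obtain ⟨r, s, rfl, rfl⟩ := hex _ _ h34
      exact h4 _ _ _ _ (hG _ _ h12) (hG _ _ h23) (hG _ _ h34) (hG _ _ h41)
        (fun h => hik ((hx _ _).2 h)) (fun h => hjl ((hx _ _).2 h)))
  have hGv : ∀ i j, G (e i) (e j) ↔ ∃ p q, P.neg p q ∧ e.symm (x p) = i ∧ e.symm (x q) = j := by
    simp only [G, Equiv.symm_apply_eq, implies_true]
  obtain ⟨v, hv⟩ : ∃ v : P.Point → Fin 4, ∀ p, e.symm (x p) = v p := ⟨_, fun _ => rfl⟩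
  simp only [hGv, hv] at he
  refine ⟨v, fun p q => by simp [← hv, hx], ?_⟩
  rcases he with ⟨⟨p, p', h1, hp, hp'⟩, ⟨q, q', h2, hq, hq'⟩, ⟨r, r', h3, hr, hr'⟩⟩ | he |
    ⟨⟨p, q, h1, hp, hq⟩, ⟨r, s, h2, hr, hs⟩, he⟩
  · exact Or.inl ⟨p, q, r, p', q', r', ⟨hp, hq, hr, hp', hq', hr'⟩, h1, h2, h3⟩
  · refine Or.inr (Or.inl fun p q h hlt => ?_)
    simp only [not_exists, not_and] at he
    have := he.1 p q h
    have := he.2.1 p q h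
    have := he.2.2.1 p q h
    have := he.2.2.2 p q h
    grind
  · refine Or.inr (Or.inr ⟨⟨p, q, r, s, ⟨hp, hq, hr, hs⟩, h1, h2⟩, fun p q h hlt => ?_⟩)
    simp only [not_exists, not_and] at he
    have := he.1 p q h
    have := he.2.1 p q h
    have := he.2.2 p q h
    grind

end Pattern

/-! ### Occurrence by labelling the points -/

namespace Pattern

variable {P : Pattern}

/-- Let the points of `P` carry labels in `Fin m`, the label `i` being reserved to points of the
variable `w i`, and let every edge, read in the order of the variables, join two labels of one of
the pairs in `L` if it is positive and in `M` if it is negative. Then `P` occurs in a listed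
pattern as soon as a map `h` of the labels respects variables, the pairs in `M`, and those pairs
in `L` that are realized by a positive edge. -/
theorem occursIn_ofEdges {m n : ℕ} {v : P.Point → Fin 4}
    (hv : ∀ p q, v p = v q ↔ P.var p = P.var q) (κ : P.Point → Fin m) (w : Fin m → Fin 4)
    (hκ : ∀ p, w (κ p) = v p) {L M : List (Fin m × Fin m)}
    (hL : ∀ p q, P.pos p q → v p < v q → (κ p, κ q) ∈ L)
    (hM : ∀ p q, P.neg p q → v p < v q → (κ p, κ q) ∈ M)
    {u : Fin n → Fin 4} {E F : List (Fin n × Fin n)} {hu hd} (h : Fin m → Fin n)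
    (hh : ∀ i, u (h i) = w i)
    (hF : ∀ e ∈ M, (h e.1, h e.2) ∈ F ∨ (h e.2, h e.1) ∈ F)
    (hE : ∀ e ∈ L, (∃ p q, κ p = e.1 ∧ κ q = e.2 ∧ P.pos p q) →
      (h e.1, h e.2) ∈ E ∨ (h e.2, h e.1) ∈ E) :
    P.OccursIn (ofEdges n u E F hu hd) := by
  have hne : ∀ {p q}, P.var p ≠ P.var q → v p < v q ∨ v q < v p := fun hpq =>
    lt_or_gt_of_ne fun h' => hpq ((hv _ _).1 h')
  refine ⟨fun p => h (κ p), fun p q => ?_, fun p q hpq => ?_, fun p q hpq => ?_⟩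
  · change u (h (κ p)) = u (h (κ q)) ↔ _
    rw [hh, hh, hκ, hκ, hv]
  · rcases hne (P.pos_var _ _ hpq) with hlt | hlt
    · exact hE _ (hL _ _ hpq hlt) ⟨p, q, rfl, rfl, hpq⟩
    · exact (hE _ (hL _ _ (P.pos_symm _ _ hpq) hlt) ⟨q, p, rfl, rfl, P.pos_symm _ _ hpq⟩).symm
  · rcases hne (P.neg_var _ _ hpq) with hlt | hlt
    · exact hF _ (hM _ _ hpq hlt)
    · exact (hF _ (hM _ _ (P.neg_symm _ _ hpq) hlt)).symm

theorem Irreducible.exists_separator (hirr : P.Irreducible) {p q : P.Point} (hne : p ≠ q)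
    (hv : P.var p = P.var q) : ∃ r, (P.pos p r ∧ P.neg q r) ∨ (P.neg p r ∧ P.pos q r) := by
  by_contra h
  exact hirr.2 p q ⟨hne, hv, h⟩

theorem Irreducible.exists_two_pos (hirr : P.Irreducible) {p : P.Point} (h : ∀ q, ¬ P.neg p q) :
    ∃ q q', q ≠ q' ∧ P.pos p q ∧ P.pos p q' := by
  by_contra! h'
  exact hirr.1 p ⟨fun q q' hq hq' => by_contra fun hne => h' q q' hne hq hq', h⟩

end Pattern

/-! ### Negative paths -/

/-- A numbering of the variables of a pattern by which the linked pairs form a path `012` or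
`0123`. Among the negative edges, which are never parallel, `α β` joins `0` to `1` and `β' γ`
joins `1` to `2`. -/
structure NegPath (P : Pattern) where
  v : P.Point → Fin 4
  v_eq : ∀ p q, v p = v q ↔ P.var p = P.var q
  α : P.Point
  β : P.Point
  β' : P.Point
  γ : P.Point
  v_α : v α = 0
  v_β : v β = 1
  v_β' : v β' = 1
  v_γ : v γ = 2
  neg_αβ : P.neg α β
  neg_βγ : P.neg β' γ
  unique : ∀ p q p' q', P.neg p q → P.neg p' q' → v p = v p' → v q = v q' → p = p' ∧ q = q'
  neg_cases : ∀ p q, P.neg p q → v p < v q →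
    (v p = 0 ∧ v q = 1) ∨ (v p = 1 ∧ v q = 2) ∨ (v p = 2 ∧ v q = 3)
  pos_cases : ∀ p q, P.pos p q → v p < v q →
    (v p = 0 ∧ v q = 1) ∨ (v p = 1 ∧ v q = 2) ∨ (v p = 2 ∧ v q = 3)

namespace NegPath

variable {P : Pattern}

theorem neg_ends (S : NegPath P) {p q : P.Point} (h : P.neg p q) :
    (p = S.α ∧ q = S.β) ∨ (p = S.β ∧ q = S.α) ∨
    (p = S.β' ∧ q = S.γ) ∨ (p = S.γ ∧ q = S.β') ∨ (S.v p = 2 ∧ S.v q = 3) ∨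
    (S.v p = 3 ∧ S.v q = 2) := by
  have h1 := S.neg_cases p q h
  have h2 := S.neg_cases q p (P.neg_symm _ _ h)
  have h3 := mt (S.v_eq p q).1 (P.neg_var _ _ h)
  have h4 := S.unique p q _ _ h S.neg_αβ
  have h5 := S.unique p q _ _ h S.neg_βγ
  have h6 := S.unique q p _ _ (P.neg_symm _ _ h) S.neg_αβ
  have h7 := S.unique q p _ _ (P.neg_symm _ _ h) S.neg_βγ
  rw [S.v_α, S.v_β] at h4 h6
  rw [S.v_β', S.v_γ] at h5 h7
  grind

theorem pos_ends (S : NegPath P) {p q : P.Point} (h : P.pos p q) : (S.v p = 0 ∧ S.v q = 1) ∨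
    (S.v p = 1 ∧ S.v q = 0) ∨ (S.v p = 1 ∧ S.v q = 2) ∨ (S.v p = 2 ∧ S.v q = 1) ∨
    (S.v p = 2 ∧ S.v q = 3) ∨ (S.v p = 3 ∧ S.v q = 2) := by
  have h1 := S.pos_cases p q h
  have h2 := S.pos_cases q p (P.pos_symm _ _ h)
  have h3 := mt (S.v_eq p q).1 (P.pos_var _ _ h)
  grind

end NegPath

/-! ### Paths without a common end of two negative edges -/

/-- A negative path in which `α β` and `β' γ` have no common end, and no negative edge joins `γ` to
the last variable. The remaining fields say that each point is joined by a positive edge to at most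
one point of the variable `0` and to at most one of the variable `2`, that the variable `2` has at
most one point besides `γ`, and that the points of at most one variable have two positive edges to
the variable `1`. -/
structure SplitPath (P : Pattern) extends NegPath P where
  ne : β ≠ β'
  neg_γ : ∀ q, P.neg γ q → q = β'
  sec : ∀ p q r, v p = 0 ∨ v p = 2 → v p = v q → P.pos p r → P.pos q r → p = q
  two : ∀ q r, v q = 2 → v r = 2 → q ≠ γ → r ≠ γ → q = r
  hub : ∀ p q q' r s s', P.pos p q → P.pos p q' → q ≠ q' → v q = 1 → v q' = 1 →
    P.pos r s → P.pos r s' → s ≠ s' → v s = 1 → v s' = 1 → v p = v r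

namespace SplitPath

variable {P : Pattern}

open Classical in
/-- The labels of the points when `α β` and `β' γ` have no common end: `0` is `α`, `1` the other
points of its variable, `2` is `β`, `3` is `β'`, `4` the other points of their variable, `5` is
`γ`, `6` the other points of its variable, `7` the points of the last variable. -/
noncomputable def splitLabel (S : SplitPath P) (p : P.Point) : Fin 8 :=
  if S.v p = 0 then (if p = S.α then 0 else 1)
  else if S.v p = 1 then (if p = S.β then 2 else if p = S.β' then 3 else 4)
  else if S.v p = 2 then (if p = S.γ then 5 else 6)
  else 7

theorem splitLabel_var (S : SplitPath P) (p : P.Point) :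
    ![0, 0, 1, 1, 1, 2, 2, 3] (S.splitLabel p) = S.v p := by
  unfold splitLabel
  have : S.v p = 0 ∨ S.v p = 1 ∨ S.v p = 2 ∨ S.v p = 3 := by generalize S.v p = i; decide +revert
  split_ifs <;> simp <;> grind

theorem splitLabel_spec (S : SplitPath P) (p : P.Point) : (S.splitLabel p = 0 → p = S.α) ∧
    (S.splitLabel p = 1 → S.v p = 0 ∧ p ≠ S.α) ∧
    (S.splitLabel p = 2 → p = S.β) ∧ (S.splitLabel p = 3 → p = S.β') ∧
    (S.splitLabel p = 4 → S.v p = 1 ∧ p ≠ S.β ∧ p ≠ S.β') ∧ (S.splitLabel p = 5 → p = S.γ) ∧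
    (S.splitLabel p = 6 → S.v p = 2 ∧ p ≠ S.γ) := by
  unfold splitLabel
  split_ifs <;> simp_all

/-- A third point of the variable of `β` is told apart from `β` only by `α`, and from `β'` only
by `γ`. -/
theorem pos_second (S : SplitPath P) (hirr : P.Irreducible) (x : P.Point) (hx : S.v x = 1)
    (hxβ : x ≠ S.β) (hxβ' : x ≠ S.β') : P.pos x S.α ∧ P.pos x S.γ := by
  have hα := S.v_α
  have hvβ := S.v_β
  have hvβ' := S.v_β'
  have hvγ := S.v_γ
  have hβ := S.ne
  have hneg : ∀ r, ¬ P.neg x r := fun r h => by have := S.neg_ends h; grind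
  obtain ⟨r, ⟨h1, h2⟩ | ⟨h1, -⟩⟩ :=
    hirr.exists_separator hxβ ((S.v_eq _ _).1 (hx.trans hvβ.symm))
  · obtain ⟨r', ⟨h3, h4⟩ | ⟨h3, -⟩⟩ :=
      hirr.exists_separator hxβ' ((S.v_eq _ _).1 (hx.trans hvβ'.symm))
    · have := S.neg_ends h2
      have := S.neg_ends h4
      grind
    · exact absurd h3 (hneg _)
  · exact absurd h1 (hneg _)

/-- A second point of the variable of `α` needs two positive edges, and they cannot end at a point
joined to `α`. -/
theorem pos_first (S : SplitPath P) (hirr : P.Irreducible) (y : P.Point) (hy : S.v y = 0)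
    (hyα : y ≠ S.α) : P.pos y S.β ∧ P.pos y S.β' := by
  have hα := S.v_α
  have hvβ := S.v_β
  have hvβ' := S.v_β'
  have hvγ := S.v_γ
  have hβ := S.ne
  have hneg : ∀ r, ¬ P.neg y r := fun r h => by have := S.neg_ends h; grind
  have hyx : ∀ r, P.pos y r → r = S.β ∨ r = S.β' := by
    intro r hr
    by_contra! hne
    have := S.pos_ends hr
    exact hyα (S.sec _ _ r (Or.inl hy) (hy.trans hα.symm) hr
      (P.pos_symm _ _ (S.pos_second hirr r (by grind) hne.1 hne.2).1))
  obtain ⟨q, q', hne, hq, hq'⟩ := hirr.exists_two_pos hneg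
  have h1 := hyx q hq
  have h2 := hyx q' hq'
  grind

/-- A point of the last variable has at most one positive edge, hence a negative one. -/
theorem neg_last (S : SplitPath P) (hirr : P.Irreducible) (c d : P.Point) (hc : S.v c = 2)
    (hcγ : c ≠ S.γ) (hd : S.v d = 3) : P.neg c d := by
  have hα := S.v_α
  have hvβ := S.v_β
  have hvβ' := S.v_β'
  have hvγ := S.v_γ
  have hβ := S.ne
  by_contra hcd
  have hneg : ∀ r, ¬ P.neg d r := fun r h => by
    have h1 := S.neg_ends h
    have h2 : S.v r = 2 := by grind
    have h3 : r ≠ S.γ := fun h' => by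
      have := S.neg_γ d (h' ▸ P.neg_symm _ _ h)
      grind
    exact hcd (S.two c r hc h2 hcγ h3 ▸ P.neg_symm _ _ h)
  obtain ⟨q, q', hne, hq, hq'⟩ := hirr.exists_two_pos hneg
  have h1 := S.pos_ends hq
  have h2 := S.pos_ends hq'
  exact hne (S.sec q q' d (by grind) (by grind) (P.pos_symm _ _ hq) (P.pos_symm _ _ hq'))

theorem splitLabel_pos (S : SplitPath P) (hirr : P.Irreducible) (p q : P.Point) (h : P.pos p q)
    (hlt : S.v p < S.v q) : (S.splitLabel p, S.splitLabel q) ∈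
      [(0, 3), (0, 4), (1, 2), (1, 3), (2, 5), (2, 6), (3, 6), (4, 5), (5, 7)] := by
  have hα := S.v_α
  have hvβ := S.v_β
  have hvβ' := S.v_β'
  have hvγ := S.v_γ
  have hβ := S.ne
  rcases S.pos_cases p q h hlt with ⟨hp, hq⟩ | ⟨hp, hq⟩ | ⟨hp, hq⟩
  · by_cases hpα : p = S.α
    · have hqβ : q ≠ S.β := fun h' => P.pos_neg _ _ h (hpα ▸ h' ▸ S.neg_αβ)
      by_cases hqβ' : q = S.β' <;> simp [splitLabel, hq, hpα, hqβ, hqβ', hα, hvβ', S.ne.symm]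
    · by_cases hqβ : q = S.β
      · simp [splitLabel, hp, hpα, hqβ, hvβ]
      · by_cases hqβ' : q = S.β'
        · simp [splitLabel, hp, hpα, hqβ', hvβ', S.ne.symm]
        · exact absurd (S.sec _ _ q (Or.inl hp) (hp.trans hα.symm) h
            (P.pos_symm _ _ (S.pos_second hirr q hq hqβ hqβ').1)) hpα
  · by_cases hqγ : q = S.γ
    · have hpβ' : p ≠ S.β' := fun h' => P.pos_neg _ _ h (hqγ ▸ h' ▸ S.neg_βγ)
      by_cases hpβ : p = S.β <;> simp [splitLabel, hp, hpβ, hpβ', hqγ, hvγ, hvβ]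
    · by_cases hpβ : p = S.β
      · simp [splitLabel, hpβ, hq, hqγ, hvβ]
      · by_cases hpβ' : p = S.β'
        · simp [splitLabel, hpβ', hq, hqγ, hvβ', S.ne.symm]
        · exact absurd (S.sec _ _ p (Or.inr hq) (hq.trans hvγ.symm) (P.pos_symm _ _ h)
            (P.pos_symm _ _ (S.pos_second hirr p hp hpβ hpβ').2)) hqγ
  · by_cases hpγ : p = S.γ
    · simp [splitLabel, hq, hpγ, hvγ]
    · exact absurd (S.neg_last hirr p q hp hpγ hq) (P.pos_neg _ _ h)

theorem splitLabel_neg (S : SplitPath P) (p q : P.Point) (h : P.neg p q) (hlt : S.v p < S.v q) :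
    (S.splitLabel p, S.splitLabel q) ∈ [(0, 2), (3, 5), (6, 7)] := by
  have hα := S.v_α
  have hvβ := S.v_β
  have hvβ' := S.v_β'
  have hvγ := S.v_γ
  have hβ := S.ne
  rcases S.neg_ends h with ⟨rfl, rfl⟩ | ⟨rfl, rfl⟩ | ⟨rfl, rfl⟩ | ⟨rfl, rfl⟩ | ⟨hp, hq⟩ | ⟨hp, hq⟩
  · simp [splitLabel, hα, hvβ]
  · simp [hα, hvβ] at hlt
  · simp [splitLabel, hvβ', hvγ, S.ne.symm]
  · simp [hvβ', hvγ] at hlt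
  · have hpγ : p ≠ S.γ := fun h' => by
      have := S.neg_γ q (h' ▸ h)
      simp [this, hvβ'] at hq
    simp [splitLabel, hp, hq, hpγ]
  · simp [hp, hq] at hlt

/-- Some positive edge joins a point with label `i` to a point with label `j`. -/
def Edge (S : SplitPath P) (i j : Fin 8) : Prop :=
  ∃ p q, S.splitLabel p = i ∧ S.splitLabel q = j ∧ P.pos p q

theorem occursIn_ofEdges (S : SplitPath P) (hirr : P.Irreducible) {n : ℕ} {u : Fin n → Fin 4}
    {E F : List (Fin n × Fin n)} {hu hd} (h : Fin 8 → Fin n)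
    (hh : ∀ i, u (h i) = ![0, 0, 1, 1, 1, 2, 2, 3] i)
    (hF : ∀ e ∈ [(0, 2), (3, 5), (6, 7)], (h e.1, h e.2) ∈ F ∨ (h e.2, h e.1) ∈ F)
    (hE : ∀ e ∈ [(0, 3), (0, 4), (1, 2), (1, 3), (2, 5), (2, 6), (3, 6), (4, 5), (5, 7)],
      S.Edge e.1 e.2 → (h e.1, h e.2) ∈ E ∨ (h e.2, h e.1) ∈ E) :
    P.OccursIn (Pattern.ofEdges n u E F hu hd) :=
  Pattern.occursIn_ofEdges S.v_eq S.splitLabel _ S.splitLabel_var (S.splitLabel_pos hirr)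
    S.splitLabel_neg h hh hF hE

/-- Irreducibility provides the positive edges at a second point of the variable of `α` and at a
third point of the variable of `β`, so that the labels `1 2` and `4 5` detect these points. -/
theorem edge_spec (S : SplitPath P) (hirr : P.Irreducible) :
    (S.Edge 0 3 ↔ P.pos S.α S.β') ∧ (S.Edge 2 5 ↔ P.pos S.β S.γ) ∧
    (S.Edge 2 6 ↔ ∃ c, (S.v c = 2 ∧ c ≠ S.γ) ∧ P.pos S.β c) ∧
    (S.Edge 3 6 ↔ ∃ c, (S.v c = 2 ∧ c ≠ S.γ) ∧ P.pos S.β' c) ∧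
    (S.Edge 4 5 ↔ ∃ x, S.v x = 1 ∧ x ≠ S.β ∧ x ≠ S.β') ∧
    (S.Edge 1 2 ↔ ∃ y, S.v y = 0 ∧ y ≠ S.α) ∧
    (S.Edge 0 4 → S.Edge 4 5) ∧ (S.Edge 1 3 → S.Edge 1 2) := by
  have hα := S.v_α
  have hvβ := S.v_β
  have hvβ' := S.v_β'
  have hvγ := S.v_γ
  have hβ := S.ne
  have hlab := S.splitLabel_spec
  have l0 : S.splitLabel S.α = 0 := by simp [splitLabel, hα]
  have l2 : S.splitLabel S.β = 2 := by simp [splitLabel, hvβ]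
  have l3 : S.splitLabel S.β' = 3 := by simp [splitLabel, hvβ', hβ.symm]
  have l5 : S.splitLabel S.γ = 5 := by simp [splitLabel, hvγ]
  have l1 : ∀ y, S.v y = 0 → y ≠ S.α → S.splitLabel y = 1 := fun y h h' => by
    simp [splitLabel, h, h']
  have l4 : ∀ x, S.v x = 1 → x ≠ S.β → x ≠ S.β' → S.splitLabel x = 4 := fun x h h' h'' => by
    simp [splitLabel, h, h', h'']
  have l6 : ∀ c, S.v c = 2 → c ≠ S.γ → S.splitLabel c = 6 := fun c h h' => by
    simp [splitLabel, h, h']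
  have e45 : S.Edge 4 5 ↔ ∃ x, S.v x = 1 ∧ x ≠ S.β ∧ x ≠ S.β' :=
    ⟨fun ⟨x, _, h, _⟩ => ⟨x, (hlab x).2.2.2.2.1 h⟩, fun ⟨x, h1, h2, h3⟩ =>
      ⟨x, S.γ, l4 x h1 h2 h3, l5, (S.pos_second hirr x h1 h2 h3).2⟩⟩
  have e12 : S.Edge 1 2 ↔ ∃ y, S.v y = 0 ∧ y ≠ S.α :=
    ⟨fun ⟨y, _, h, _⟩ => ⟨y, (hlab y).2.1 h⟩, fun ⟨y, h1, h2⟩ =>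
      ⟨y, S.β, l1 y h1 h2, l2, (S.pos_first hirr y h1 h2).1⟩⟩
  refine ⟨⟨fun ⟨p, q, h1, h2, h⟩ => ?_, fun h => ⟨_, _, l0, l3, h⟩⟩,
    ⟨fun ⟨p, q, h1, h2, h⟩ => ?_, fun h => ⟨_, _, l2, l5, h⟩⟩,
    ⟨fun ⟨p, q, h1, h2, h⟩ => ⟨q, (hlab q).2.2.2.2.2.2 h2, ?_⟩,
      fun ⟨c, hc, h⟩ => ⟨_, _, l2, l6 c hc.1 hc.2, h⟩⟩,
    ⟨fun ⟨p, q, h1, h2, h⟩ => ⟨q, (hlab q).2.2.2.2.2.2 h2, ?_⟩,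
      fun ⟨c, hc, h⟩ => ⟨_, _, l3, l6 c hc.1 hc.2, h⟩⟩, e45, e12,
    fun ⟨_, x, _, h, _⟩ => e45.2 ⟨x, (hlab x).2.2.2.2.1 h⟩,
    fun ⟨y, _, h, _⟩ => e12.2 ⟨y, (hlab y).2.1 h⟩⟩
  · rwa [← (hlab p).1 h1, ← (hlab q).2.2.2.1 h2]
  · rwa [← (hlab p).2.2.1 h1, ← (hlab q).2.2.2.2.2.1 h2]
  · rwa [← (hlab p).2.2.1 h1]
  · rwa [← (hlab p).2.2.2.1 h1]

/-- The mutual exclusions between the positive edges. -/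
theorem edge_restrictions (S : SplitPath P) (hirr : P.Irreducible) :
    (S.Edge 0 4 → S.Edge 4 5) ∧ (S.Edge 1 3 → S.Edge 1 2) ∧
    (S.Edge 0 3 ∨ S.Edge 2 5) ∧ (S.Edge 1 2 → ¬ S.Edge 0 3) ∧ (S.Edge 2 5 → ¬ S.Edge 2 6) ∧
    (S.Edge 4 5 → S.Edge 1 2 → ¬ S.Edge 2 5) ∧ (S.Edge 4 5 → S.Edge 0 3 → ¬ S.Edge 2 5) ∧
    (S.Edge 4 5 → S.Edge 0 3 → S.Edge 2 6 → ¬ S.Edge 3 6) := by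
  have hα := S.v_α
  have hvβ := S.v_β
  have hvβ' := S.v_β'
  have hvγ := S.v_γ
  have hβ := S.ne
  obtain ⟨hA, hB, hC, hD, hX, hY, e04, e13⟩ := S.edge_spec hirr
  refine ⟨e04, e13, ?_⟩
  generalize S.Edge 0 3 = A, S.Edge 2 5 = B, S.Edge 2 6 = C, S.Edge 3 6 = D, S.Edge 4 5 = X,
    S.Edge 1 2 = Y at hA hB hC hD hX hY ⊢
  have hAB : A ∨ B := by
    obtain ⟨r, ⟨h1, h2⟩ | ⟨h1, h2⟩⟩ :=
      hirr.exists_separator S.ne ((S.v_eq _ _).1 (hvβ.trans hvβ'.symm)) <;>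
      have h3 := S.neg_ends ‹_› <;> have h4 := P.pos_symm _ _ ‹P.pos _ r› <;> grind
  have hYA : Y → ¬ A := fun h1 h2 => by
    obtain ⟨y, hy0, hyα⟩ := hY.1 h1
    exact hyα (S.sec _ _ _ (Or.inl hy0) (hy0.trans hα.symm) (S.pos_first hirr y hy0 hyα).2
      (hA.1 h2))
  have hBC : B → ¬ C := fun h1 h2 => by
    obtain ⟨c, ⟨hc, hcγ⟩, h⟩ := hC.1 h2
    exact hcγ (S.sec _ _ _ (Or.inr hc) (hc.trans hvγ.symm) (P.pos_symm _ _ h)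
      (P.pos_symm _ _ (hB.1 h1)))
  have hXYB : X → Y → ¬ B := fun h1 h2 h3 => by
    obtain ⟨x, hx1, hxβ, hxβ'⟩ := hX.1 h1
    obtain ⟨y, hy0, hyα⟩ := hY.1 h2
    have := S.hub _ _ _ _ _ _ (S.pos_first hirr y hy0 hyα).1 (S.pos_first hirr y hy0 hyα).2
      S.ne hvβ hvβ' (P.pos_symm _ _ (hB.1 h3))
      (P.pos_symm _ _ (S.pos_second hirr x hx1 hxβ hxβ').2) hxβ.symm hvβ hx1
    grind
  have hXAB : X → A → ¬ B := fun h1 h2 h3 => by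
    obtain ⟨x, hx1, hxβ, hxβ'⟩ := hX.1 h1
    have := S.hub _ _ _ _ _ _ (hA.1 h2)
      (P.pos_symm _ _ (S.pos_second hirr x hx1 hxβ hxβ').1) hxβ'.symm hvβ' hx1
      (P.pos_symm _ _ (hB.1 h3))
      (P.pos_symm _ _ (S.pos_second hirr x hx1 hxβ hxβ').2) hxβ.symm hvβ hx1
    grind
  have hXACD : X → A → C → ¬ D := fun h1 h2 h3 h4 => by
    obtain ⟨x, hx1, hxβ, hxβ'⟩ := hX.1 h1
    obtain ⟨c, ⟨hc, hcγ⟩, h5⟩ := hC.1 h3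
    obtain ⟨c', ⟨hc', hcγ'⟩, h6⟩ := hD.1 h4
    obtain rfl := S.two c c' hc hc' hcγ hcγ'
    have := S.hub _ _ _ _ _ _ (hA.1 h2)
      (P.pos_symm _ _ (S.pos_second hirr x hx1 hxβ hxβ').1) hxβ'.symm hvβ' hx1
      (P.pos_symm _ _ h5) (P.pos_symm _ _ h6) S.ne hvβ hvβ'
    grind
  exact ⟨hAB, hYA, hBC, hXYB, hXAB, hXACD⟩

/-- The positive edges decide which pattern is reached: R6 if the variable of `α` has a second
point; else R7, R9 or R8 if the variable of `β` has a third point, according to whether `β` is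
joined to `γ`, to another point of the variable of `γ`, or to neither; else R5 or R10, according to
whether `β` is joined to `γ`. The vectors list the images of the labels; those of labels that do
not occur are immaterial. -/
theorem occurs (S : SplitPath P) (hirr : P.Irreducible) :
    P.OccursIn patternR5 ∨ P.OccursIn patternR6 ∨ P.OccursIn patternR7 ∨ P.OccursIn patternR8 ∨
      P.OccursIn patternR9 ∨ P.OccursIn patternR10 := by
  obtain ⟨e04, e13, hAB, hYA, hBC, hXYB, hXAB, hXACD⟩ := S.edge_restrictions hirr
  by_cases hYc : S.Edge 1 2
  · refine Or.inr (Or.inl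
      (S.occursIn_ofEdges hirr ![1, 0, 3, 2, 2, 4, 5, 6] (by decide) (by decide) ?_))
    intro e he
    fin_cases he <;> first | (intro _; decide) | (intro h; exfalso; tauto)
  · by_cases hXc : S.Edge 4 5
    · by_cases hBc : S.Edge 2 5
      · refine Or.inr (Or.inr (Or.inl
          (S.occursIn_ofEdges hirr ![0, 0, 2, 1, 3, 4, 5, 6] (by decide) (by decide) ?_)))
        intro e he
        fin_cases he <;> first | (intro _; decide) | (intro h; exfalso; tauto)
      · by_cases hCc : S.Edge 2 6
        · refine Or.inr (Or.inr (Or.inr (Or.inr (Or.inl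
            (S.occursIn_ofEdges hirr ![0, 0, 2, 1, 3, 4, 5, 6] (by decide) (by decide) ?_)))))
          intro e he
          fin_cases he <;> first | (intro _; decide) | (intro h; exfalso; tauto)
        · refine Or.inr (Or.inr (Or.inr (Or.inl
            (S.occursIn_ofEdges hirr ![0, 0, 2, 1, 3, 4, 5, 6] (by decide) (by decide) ?_))))
          intro e he
          fin_cases he <;> first | (intro _; decide) | (intro h; exfalso; tauto)
    · by_cases hBc : S.Edge 2 5
      · refine Or.inl (S.occursIn_ofEdges hirr ![0, 0, 2, 1, 1, 3, 4, 5] (by decide) (by decide) ?_)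
        intro e he
        fin_cases he <;> first | (intro _; decide) | (intro h; exfalso; tauto)
      · refine Or.inr (Or.inr (Or.inr (Or.inr (Or.inr
          (S.occursIn_ofEdges hirr ![0, 0, 2, 1, 1, 3, 4, 5] (by decide) (by decide) ?_)))))
        intro e he
        fin_cases he <;> first | (intro _; decide) | (intro h; exfalso; tauto)

end SplitPath

/-! ### Paths in which two negative edges have a common end -/

/-- A negative path in which `β` is the common end of two negative edges, and no negative edge
joins `γ` to the last variable. The remaining fields say that no point is joined to
both `α` and `γ` by positive edges, and that the variable `2` has at most one point besides `γ`. -/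
structure SharedPath (P : Pattern) extends NegPath P where
  eq : β' = β
  neg_γ : ∀ q, P.neg γ q → q = β
  half : ∀ x, v x = 1 → P.pos x α → ¬ P.pos x γ
  two : ∀ q r, v q = 2 → v r = 2 → q ≠ γ → r ≠ γ → q = r

namespace SharedPath

variable {P : Pattern}

theorem not_neg_second (S : SharedPath P) {x : P.Point} (hx : S.v x = 1) (hxβ : x ≠ S.β)
    (r : P.Point) : ¬ P.neg x r := fun h => by
  have := S.neg_ends h
  have := S.v_α
  have := S.v_γ
  have := S.eq
  grind

theorem not_neg_first (S : SharedPath P) {y : P.Point} (hy : S.v y = 0) (hyα : y ≠ S.α)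
    (r : P.Point) : ¬ P.neg y r := fun h => by
  have := S.neg_ends h
  have := S.v_β
  have := S.v_γ
  have := S.eq
  grind

theorem eq_of_neg_β (S : SharedPath P) {r : P.Point} (h : P.neg S.β r) : r = S.α ∨ r = S.γ := by
  have := S.neg_ends h
  have := S.v_β
  have := S.v_α
  have := S.v_γ
  have := S.eq
  grind

/-- There are at most two points in the variable of `β`: two further points, which have no
negative edges, could not be told apart. -/
theorem eq_second (S : SharedPath P) (hirr : P.Irreducible) {x x' : P.Point} (hx : S.v x = 1)
    (hxβ : x ≠ S.β) (hx' : S.v x' = 1) (hxβ' : x' ≠ S.β) : x = x' := by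
  by_contra hne
  obtain ⟨r, ⟨-, h⟩ | ⟨h, -⟩⟩ := hirr.exists_separator hne ((S.v_eq _ _).1 (hx.trans hx'.symm))
  · exact S.not_neg_second hx' hxβ' r h
  · exact S.not_neg_second hx hxβ r h

/-- The second point of the variable of `β` is told apart from `β` by `α` or by `γ`. -/
theorem pos_second (S : SharedPath P) (hirr : P.Irreducible) {x : P.Point} (hx : S.v x = 1)
    (hxβ : x ≠ S.β) : P.pos x S.α ∨ P.pos x S.γ := by
  obtain ⟨r, ⟨h1, h2⟩ | ⟨h, -⟩⟩ :=
    hirr.exists_separator hxβ ((S.v_eq _ _).1 (hx.trans S.v_β.symm))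
  · rcases S.eq_of_neg_β h2 with rfl | rfl
    exacts [Or.inl h1, Or.inr h1]
  · exact absurd h (S.not_neg_second hx hxβ r)

theorem not_neg_γ (S : SharedPath P) {d : P.Point} (hd : S.v d = 3) : ¬ P.neg S.γ d := fun h => by
  have := S.neg_γ d h
  have := S.v_β
  grind

/-- A point of the last variable that has a negative edge has no positive edge to the second point
of the variable of `γ`. -/
theorem not_pos_of_neg (S : SharedPath P) {c d r : P.Point} (hc : S.v c = 2) (hcγ : c ≠ S.γ)
    (hd : S.v d = 3) (h : P.neg d r) : ¬ P.pos c d := by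
  have hr : S.v r = 2 := by
    have := S.neg_ends h
    have := S.v_α
    have := S.v_β
    have := S.v_β'
    have := S.v_γ
    grind
  have hrγ : r ≠ S.γ := fun h' => S.not_neg_γ hd (h' ▸ P.neg_symm _ _ h)
  rw [S.two c r hc hr hcγ hrγ]
  exact fun h' => P.pos_neg _ _ h' (P.neg_symm _ _ h)

/-! ### Common ends: single supports in the even variables -/

open Classical in
/-- The labels of the points: `0` is `α`, `1` the other points of its variable, `2` is `β`, `3`
the other point of its variable, `4` is `γ`, `5` the other point of its variable, `6` the points
of the last variable. -/
noncomputable def evenLabel (S : SharedPath P) (p : P.Point) : Fin 7 :=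
  if S.v p = 0 then (if p = S.α then 0 else 1)
  else if S.v p = 1 then (if p = S.β then 2 else 3)
  else if S.v p = 2 then (if p = S.γ then 4 else 5)
  else 6

theorem evenLabel_var (S : SharedPath P) (p : P.Point) :
    ![0, 0, 1, 1, 2, 2, 3] (S.evenLabel p) = S.v p := by
  unfold evenLabel
  have : S.v p = 0 ∨ S.v p = 1 ∨ S.v p = 2 ∨ S.v p = 3 := by generalize S.v p = i; decide +revert
  split_ifs <;> simp <;> grind

theorem evenLabel_spec (S : SharedPath P) (p : P.Point) : (S.evenLabel p = 0 → p = S.α) ∧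
    (S.evenLabel p = 1 → S.v p = 0 ∧ p ≠ S.α) ∧ (S.evenLabel p = 2 → p = S.β) ∧
    (S.evenLabel p = 3 → S.v p = 1 ∧ p ≠ S.β) ∧ (S.evenLabel p = 4 → p = S.γ) ∧
    (S.evenLabel p = 5 → S.v p = 2 ∧ p ≠ S.γ) := by
  unfold evenLabel
  split_ifs <;> simp_all

theorem evenLabel_neg (S : SharedPath P) (p q : P.Point) (h : P.neg p q) (hlt : S.v p < S.v q) :
    (S.evenLabel p, S.evenLabel q) ∈ [(0, 2), (2, 4), (5, 6)] := by
  have hα := S.v_α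
  have hβ := S.v_β
  have hγ := S.v_γ
  have h' := S.neg_ends h
  rw [S.eq] at h'
  rcases h' with ⟨rfl, rfl⟩ | ⟨rfl, rfl⟩ | ⟨rfl, rfl⟩ | ⟨rfl, rfl⟩ | ⟨hp, hq⟩ | ⟨hp, hq⟩
  · simp [evenLabel, hα, hβ]
  · simp [hα, hβ] at hlt
  · simp [evenLabel, hβ, hγ]
  · simp [hβ, hγ] at hlt
  · have hpγ : p ≠ S.γ := fun h' => S.not_neg_γ hq (h' ▸ h)
    simp [evenLabel, hp, hq, hpγ]
  · simp [hp, hq] at hlt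

theorem evenLabel_pos (S : SharedPath P) (hirr : P.Irreducible)
    (hsec : ∀ p q r, S.v p = 0 ∨ S.v p = 2 → S.v p = S.v q → P.pos p r → P.pos q r → p = q)
    (p q : P.Point) (h : P.pos p q) (hlt : S.v p < S.v q) :
    (S.evenLabel p, S.evenLabel q) ∈
      [(0, 3), (1, 2), (1, 3), (2, 5), (3, 4), (3, 5), (4, 6)] := by
  have hα := S.v_α
  have hβ := S.v_β
  have hγ := S.v_γ
  rcases S.pos_cases p q h hlt with ⟨hp, hq⟩ | ⟨hp, hq⟩ | ⟨hp, hq⟩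
  · have : ¬ (p = S.α ∧ q = S.β) := by rintro ⟨rfl, rfl⟩; exact P.pos_neg _ _ h S.neg_αβ
    by_cases hpα : p = S.α <;> by_cases hqβ : q = S.β <;> simp_all [evenLabel]
  · have : ¬ (p = S.β ∧ q = S.γ) := by
      rintro ⟨rfl, rfl⟩; exact P.pos_neg _ _ h (S.eq ▸ S.neg_βγ)
    by_cases hpβ : p = S.β <;> by_cases hqγ : q = S.γ <;> simp_all [evenLabel]
  · by_cases hpγ : p = S.γ
    · simp_all [evenLabel]
    · obtain ⟨r, hr⟩ : ∃ r, P.neg q r := by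
        by_contra! hneg
        obtain ⟨c, c', hne, hc, hc'⟩ := hirr.exists_two_pos hneg
        have h1 := S.pos_ends hc
        have h2 := S.pos_ends hc'
        exact hne (hsec c c' q (by grind) (by grind) (P.pos_symm _ _ hc) (P.pos_symm _ _ hc'))
      exact absurd h (S.not_pos_of_neg hp hpγ hq hr)

/-- Suppose that each point is joined by a positive edge to at most one point of the variable `0`
and to at most one of the variable `2`. If some point of the variable of `β` is joined to `α`, then
`α` is the only point of its variable, and R1 is reached, otherwise R2. -/
theorem occurs_of_sec_even (S : SharedPath P) (hirr : P.Irreducible)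
    (hsec : ∀ p q r, S.v p = 0 ∨ S.v p = 2 → S.v p = S.v q → P.pos p r → P.pos q r → p = q) :
    P.OccursIn patternR1 ∨ P.OccursIn patternR2 := by
  have occ := fun {n : ℕ} {u : Fin n → Fin 4} {E F : List (Fin n × Fin n)} {hu hd} =>
    Pattern.occursIn_ofEdges (n := n) (u := u) (E := E) (F := F) (hu := hu) (hd := hd) S.v_eq
      S.evenLabel _ S.evenLabel_var (S.evenLabel_pos hirr hsec) S.evenLabel_neg
  have hlab := S.evenLabel_spec
  by_cases hX : ∃ x, S.v x = 1 ∧ P.pos x S.α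
  · obtain ⟨x, hx, hxα⟩ := hX
    have hxβ : x ≠ S.β := fun h => P.pos_neg _ _ hxα (h ▸ P.neg_symm _ _ S.neg_αβ)
    have hone : ∀ y, S.v y = 0 → y = S.α := by
      intro y hy
      by_contra hyα
      obtain ⟨q, q', hne, hq, hq'⟩ := hirr.exists_two_pos (S.not_neg_first hy hyα)
      have h1 := S.pos_ends hq
      have h2 := S.pos_ends hq'
      have h3 : ∀ r, P.pos y r → S.v r = 1 → r = S.β := fun r hr hr1 => by
        by_contra hrβ
        obtain rfl := S.eq_second hirr hx hxβ hr1 hrβ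
        exact hyα (hsec y S.α x (Or.inl hy) (hy.trans S.v_α.symm) hr (P.pos_symm _ _ hxα))
      have := h3 q hq
      have := h3 q' hq'
      grind
    refine Or.inl (occ ![0, 0, 2, 1, 4, 3, 5] (by decide) (by decide) ?_)
    have e34 : ∀ p q, S.evenLabel p = 3 → S.evenLabel q = 4 → ¬ P.pos p q := fun p q hp hq h => by
      have h1 := (hlab p).2.2.2.1 hp
      obtain rfl := S.eq_second hirr hx hxβ h1.1 h1.2
      exact S.half x hx hxα ((hlab q).2.2.2.2.1 hq ▸ h)
    have e1 : ∀ p, S.evenLabel p ≠ 1 := fun p hp =>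
      ((hlab p).2.1 hp).2 (hone p ((hlab p).2.1 hp).1)
    clear occ hlab
    intro e he
    fin_cases he <;> first | (intro _; decide) | (rintro ⟨p, q, hp, hq, h⟩; exfalso; grind)
  · push Not at hX
    refine Or.inr (occ ![1, 0, 3, 2, 5, 4, 6] (by decide) (by decide) ?_)
    have e03 : ∀ p q, S.evenLabel p = 0 → S.evenLabel q = 3 → ¬ P.pos p q := fun p q hp hq h =>
      hX q ((hlab q).2.2.2.1 hq).1 ((hlab p).1 hp ▸ P.pos_symm _ _ h)
    have e35 : ∀ p q, S.evenLabel p = 3 → S.evenLabel q = 5 → ¬ P.pos p q := fun p q hp hq h => by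
      have h1 := (hlab p).2.2.2.1 hp
      have h2 := (hlab q).2.2.2.2.2 hq
      exact h2.2 (hsec _ _ p (Or.inr h2.1) (h2.1.trans S.v_γ.symm) (P.pos_symm _ _ h)
        (P.pos_symm _ _ ((S.pos_second hirr h1.1 h1.2).resolve_left (hX p h1.1))))
    clear occ hlab
    intro e he
    fin_cases he <;> first | (intro _; decide) | (rintro ⟨p, q, hp, hq, h⟩; exfalso; grind)

/-! ### Common ends: single supports in the odd variables -/

open Classical in
/-- The labels of the points: `0` for the first variable, `1` is `β`, `2` the other point of its
variable, `3` is `γ`, `4` the other point of its variable; in the last variable, `5` for the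
points on a negative edge and `6` for the others. -/
noncomputable def oddLabel (S : SharedPath P) (p : P.Point) : Fin 7 :=
  if S.v p = 0 then 0
  else if S.v p = 1 then (if p = S.β then 1 else 2)
  else if S.v p = 2 then (if p = S.γ then 3 else 4)
  else (if ∃ q, P.neg p q then 5 else 6)

theorem oddLabel_var (S : SharedPath P) (p : P.Point) :
    ![0, 1, 1, 2, 2, 3, 3] (S.oddLabel p) = S.v p := by
  unfold oddLabel
  have : S.v p = 0 ∨ S.v p = 1 ∨ S.v p = 2 ∨ S.v p = 3 := by generalize S.v p = i; decide +revert
  split_ifs <;> simp <;> grind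

theorem oddLabel_spec (S : SharedPath P) (p : P.Point) : (S.oddLabel p = 0 → S.v p = 0) ∧
    (S.oddLabel p = 1 → p = S.β) ∧ (S.oddLabel p = 2 → S.v p = 1 ∧ p ≠ S.β) ∧
    (S.oddLabel p = 3 → p = S.γ) ∧ (S.oddLabel p = 4 → S.v p = 2 ∧ p ≠ S.γ) ∧
    (S.oddLabel p = 5 → S.v p = 3 ∧ ∃ q, P.neg p q) ∧
    (S.oddLabel p = 6 → S.v p = 3 ∧ ∀ q, ¬ P.neg p q) := by
  have : S.v p = 0 ∨ S.v p = 1 ∨ S.v p = 2 ∨ S.v p = 3 := by generalize S.v p = i; decide +revert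
  unfold oddLabel
  split_ifs <;> simp_all

theorem oddLabel_neg (S : SharedPath P) (p q : P.Point) (h : P.neg p q) (hlt : S.v p < S.v q) :
    (S.oddLabel p, S.oddLabel q) ∈ [(0, 1), (1, 3), (4, 5)] := by
  have hα := S.v_α
  have hβ := S.v_β
  have hγ := S.v_γ
  have h' := S.neg_ends h
  rw [S.eq] at h'
  rcases h' with ⟨rfl, rfl⟩ | ⟨rfl, rfl⟩ | ⟨rfl, rfl⟩ | ⟨rfl, rfl⟩ | ⟨hp, hq⟩ | ⟨hp, hq⟩
  · simp [oddLabel, hα, hβ]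
  · simp [hα, hβ] at hlt
  · simp [oddLabel, hβ, hγ]
  · simp [hβ, hγ] at hlt
  · have hpγ : p ≠ S.γ := fun h' => S.not_neg_γ hq (h' ▸ h)
    have hqp : ∃ r, P.neg q r := ⟨p, P.neg_symm _ _ h⟩
    simp [oddLabel, hp, hq, hpγ, hqp]
  · simp [hp, hq] at hlt

theorem oddLabel_pos (S : SharedPath P) (hirr : P.Irreducible)
    (hsec : ∀ p q r, S.v p = 1 ∨ S.v p = 3 → S.v p = S.v q → P.pos p r → P.pos q r → p = q)
    (p q : P.Point) (h : P.pos p q) (hlt : S.v p < S.v q) :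
    (S.oddLabel p, S.oddLabel q) ∈
      [(0, 2), (1, 4), (2, 3), (2, 4), (3, 5), (3, 6), (4, 6)] := by
  have hα := S.v_α
  have hβ := S.v_β
  have hγ := S.v_γ
  rcases S.pos_cases p q h hlt with ⟨hp, hq⟩ | ⟨hp, hq⟩ | ⟨hp, hq⟩
  · have hpα : p = S.α := by
      by_contra hpα
      obtain ⟨r, r', hne, hr, hr'⟩ := hirr.exists_two_pos (S.not_neg_first hp hpα)
      have h1 := S.pos_ends hr
      have h2 := S.pos_ends hr'
      exact hne (hsec r r' p (by grind) (by grind) (P.pos_symm _ _ hr) (P.pos_symm _ _ hr'))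
    have hqβ : q ≠ S.β := by rintro rfl; exact P.pos_neg _ _ h (hpα ▸ S.neg_αβ)
    simp_all [oddLabel]
  · have : ¬ (p = S.β ∧ q = S.γ) := by
      rintro ⟨rfl, rfl⟩; exact P.pos_neg _ _ h (S.eq ▸ S.neg_βγ)
    by_cases hpβ : p = S.β <;> by_cases hqγ : q = S.γ <;> simp_all [oddLabel]
  · by_cases hr : ∃ r, P.neg q r
    · by_cases hpγ : p = S.γ
      · simp_all [oddLabel]
      · exact absurd h (S.not_pos_of_neg hp hpγ hq hr.choose_spec)
    · by_cases hpγ : p = S.γ <;> simp_all [oddLabel]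

/-- Suppose that each point is joined by a positive edge to at most one point of the variable `1`
and to at most one of the variable `3`. A second point of the variable of `β` excludes positive
edges from `β` to the variable of `γ`, while a point of the last variable without negative edges
forces one, because `γ` and the second point of its variable must be told apart. So these two points
do not coexist. R3 is reached if there is such a point of the last variable, otherwise R1 or R4. -/
theorem occurs_of_sec_odd (S : SharedPath P) (hirr : P.Irreducible)
    (hsec : ∀ p q r, S.v p = 1 ∨ S.v p = 3 → S.v p = S.v q → P.pos p r → P.pos q r → p = q) :
    P.OccursIn patternR1 ∨ P.OccursIn patternR3 ∨ P.OccursIn patternR4 := by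
  have occ := fun {n : ℕ} {u : Fin n → Fin 4} {E F : List (Fin n × Fin n)} {hu hd} =>
    Pattern.occursIn_ofEdges (n := n) (u := u) (E := E) (F := F) (hu := hu) (hd := hd) S.v_eq
      S.oddLabel _ S.oddLabel_var (S.oddLabel_pos hirr hsec) S.oddLabel_neg
  have hlab := S.oddLabel_spec
  have hα := S.v_α
  have hβ := S.v_β
  have hγ := S.v_γ
  have hα' : ∀ y r, S.v y = 0 → P.pos y r → y = S.α := by
    intro y r hy hr
    by_contra hyα
    obtain ⟨q, q', hne, hq, hq'⟩ := hirr.exists_two_pos (S.not_neg_first hy hyα)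
    have h1 := S.pos_ends hq
    have h2 := S.pos_ends hq'
    exact hne (hsec q q' y (by grind) (by grind) (P.pos_symm _ _ hq) (P.pos_symm _ _ hq'))
  have hx : ∀ x, S.v x = 1 → x ≠ S.β → ∃ c, S.v c = 2 ∧ c ≠ S.γ ∧ P.pos x c := by
    intro x hx hxβ
    by_contra! hc
    obtain ⟨q, q', hne, hq, hq'⟩ := hirr.exists_two_pos (S.not_neg_second hx hxβ)
    have key : ∀ r, P.pos x r → r = S.α ∨ r = S.γ := by
      intro r hr
      have h1 := S.pos_ends hr
      have h2 := hα' r x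
      have h3 := hc r
      have := P.pos_symm _ _ hr
      grind
    have h1 := key q hq
    have h2 := key q' hq'
    have h3 := S.half x hx
    grind
  have hxβc : ∀ x, S.v x = 1 → x ≠ S.β → ∀ c, S.v c = 2 → c ≠ S.γ → ¬ P.pos S.β c := by
    intro x hx1 hxβ c hc hcγ h
    obtain ⟨c', hc', hcγ', h'⟩ := hx x hx1 hxβ
    obtain rfl := S.two c c' hc hc' hcγ hcγ'
    exact hxβ (hsec _ _ c (Or.inl hx1) (hx1.trans hβ.symm) h' h)
  have e14 : (∃ x, S.v x = 1 ∧ x ≠ S.β) → ∀ p q, S.oddLabel p = 1 → S.oddLabel q = 4 →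
      ¬ P.pos p q := by
    rintro ⟨x, hx1, hxβ⟩ p q hp hq h
    have hc := (hlab q).2.2.2.2.1 hq
    exact hxβc x hx1 hxβ q hc.1 hc.2 ((hlab p).2.1 hp ▸ h)
  by_cases hY : ∃ y, S.v y = 3 ∧ ∀ q, ¬ P.neg y q
  · obtain ⟨y, hy, hneg⟩ := hY
    have hy' : P.pos y S.γ ∧ ∃ c, S.v c = 2 ∧ c ≠ S.γ ∧ P.pos y c := by
      obtain ⟨q, q', hne, hq, hq'⟩ := hirr.exists_two_pos hneg
      have h1 := S.pos_ends hq
      have h2 := S.pos_ends hq'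
      have h3 := S.two q q'
      by_cases hqγ : q = S.γ <;> by_cases hqγ' : q' = S.γ <;> grind
    obtain ⟨hyγ, c, hc, hcγ, hyc⟩ := hy'
    have e35 : ∀ d, S.v d = 3 → (∃ r, P.neg d r) → ¬ P.pos S.γ d := by
      rintro d hd ⟨r, hr⟩ h
      obtain rfl := hsec y d S.γ (Or.inr hy) (hy.trans hd.symm) hyγ (P.pos_symm _ _ h)
      exact hneg r hr
    have hβc : P.pos S.β c := by
      obtain ⟨r, ⟨h1, h2⟩ | ⟨h1, h2⟩⟩ :=
        hirr.exists_separator hcγ ((S.v_eq _ _).1 (hc.trans hγ.symm))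
      · exact S.neg_γ r h2 ▸ P.pos_symm _ _ h1
      · have h3 := S.neg_ends h1
        have := S.v_β'
        exact absurd h2 (e35 r (by grind) ⟨c, P.neg_symm _ _ h1⟩)
    have e2 : ∀ p, S.oddLabel p ≠ 2 := fun p hp =>
      hxβc p ((hlab p).2.2.1 hp).1 ((hlab p).2.2.1 hp).2 c hc hcγ hβc
    have e35' : ∀ p q, S.oddLabel p = 3 → S.oddLabel q = 5 → ¬ P.pos p q := fun p q hp hq h =>
      e35 q ((hlab q).2.2.2.2.2.1 hq).1 ((hlab q).2.2.2.2.2.1 hq).2 ((hlab p).2.2.2.1 hp ▸ h)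
    refine Or.inr (Or.inl (occ ![0, 1, 1, 3, 2, 4, 5] (by decide) (by decide) ?_))
    clear * - e2 e35'
    intro e he
    fin_cases he <;> first | (intro _; decide) | (rintro ⟨p, q, hp, hq, h⟩; exfalso; grind)
  · have e6 : ∀ p, S.oddLabel p ≠ 6 := fun p hp => hY ⟨p, (hlab p).2.2.2.2.2.2 hp⟩
    by_cases hX : ∃ x, S.v x = 1 ∧ x ≠ S.β
    · replace e14 := e14 hX
      obtain ⟨x, hx1, hxβ⟩ := hX
      have hxx : ∀ p, S.oddLabel p = 2 → p = x := fun p hp =>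
        S.eq_second hirr ((hlab p).2.2.1 hp).1 ((hlab p).2.2.1 hp).2 hx1 hxβ
      rcases S.pos_second hirr hx1 hxβ with hxα | hxγ
      · have e23 : ∀ p q, S.oddLabel p = 2 → S.oddLabel q = 3 → ¬ P.pos p q := fun p q hp hq h =>
          S.half x hx1 hxα (hxx p hp ▸ (hlab q).2.2.2.1 hq ▸ h)
        refine Or.inl (occ ![0, 2, 1, 4, 3, 5, 5] (by decide) (by decide) ?_)
        clear * - e23 e14 e6
        intro e he
        fin_cases he <;> first | (intro _; decide) | (rintro ⟨p, q, hp, hq, h⟩; exfalso; grind)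
      · have e02 : ∀ p q, S.oddLabel p = 0 → S.oddLabel q = 2 → ¬ P.pos p q := fun p q hp hq h => by
          have h1 := hα' p q ((hlab p).1 hp) h
          exact S.half x hx1 (P.pos_symm _ _ (hxx q hq ▸ h1 ▸ h)) hxγ
        refine Or.inr (Or.inr (occ ![0, 2, 1, 4, 3, 5, 5] (by decide) (by decide) ?_))
        clear * - e02 e14 e6
        intro e he
        fin_cases he <;> first | (intro _; decide) | (rintro ⟨p, q, hp, hq, h⟩; exfalso; grind)
    · have e2 : ∀ p, S.oddLabel p ≠ 2 := fun p hp => hX ⟨p, (hlab p).2.2.1 hp⟩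
      refine Or.inl (occ ![0, 2, 1, 4, 3, 5, 5] (by decide) (by decide) ?_)
      clear * - e2 e6
      intro e he
      fin_cases he <;> first | (intro _; decide) | (rintro ⟨p, q, hp, hq, h⟩; exfalso; grind)

end SharedPath

/-! ### Negative stars -/

/-- Three variables with a single point `ℓ j` each, linked to the variable `b`, the negative edge
at `ℓ j` being `ℓ j c j`. The points `c j` are not all equal. Each `ℓ j` is on at most
one positive edge, and if two of the points `c j` coincide, then no point of `b` is joined to two
leaves by positive edges. -/
structure NegStar (P : Pattern) where
  b : P.Var
  ℓ : Fin 3 → P.Point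
  c : Fin 3 → P.Point
  var_c : ∀ j, P.var (c j) = b
  var_ℓ : ∀ j, P.var (ℓ j) ≠ b
  inj : ∀ i j, P.var (ℓ i) = P.var (ℓ j) → i = j
  all : ∀ p, P.var p = b ∨ ∃ j, p = ℓ j
  neg_iff : ∀ j p, P.neg (ℓ j) p ↔ p = c j
  pos_var : ∀ j p, P.pos (ℓ j) p → P.var p = b
  pos_unique : ∀ j p q, P.pos (ℓ j) p → P.pos (ℓ j) q → p = q
  not_all_eq : ¬ (c 0 = c 1 ∧ c 0 = c 2)
  half : ∀ i j, i ≠ j → c i = c j → ∀ k l, k ≠ l → ∀ x, P.pos (ℓ k) x → ¬ P.pos (ℓ l) x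

namespace NegStar

variable {P : Pattern}

/-- The same star with its leaves permuted. -/
def reindex (S : NegStar P) (σ : Equiv.Perm (Fin 3)) : NegStar P where
  b := S.b
  ℓ j := S.ℓ (σ j)
  c j := S.c (σ j)
  var_c j := S.var_c _
  var_ℓ j := S.var_ℓ _
  inj i j h := σ.injective (S.inj _ _ h)
  all p := (S.all p).imp_right fun ⟨j, hj⟩ => ⟨σ.symm j, by simpa using hj⟩
  neg_iff j := S.neg_iff _
  pos_var j := S.pos_var _
  pos_unique j := S.pos_unique _
  not_all_eq := fun ⟨h1, h2⟩ => S.not_all_eq (by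
    have key : ∀ j, S.c j = S.c (σ 0) := fun j => by
      obtain ⟨i, rfl⟩ := σ.surjective j
      fin_cases i
      exacts [rfl, h1.symm, h2.symm]
    exact ⟨(key 0).trans (key 1).symm, (key 0).trans (key 2).symm⟩)
  half i j hij h k l hkl := S.half _ _ (σ.injective.ne hij) h _ _ (σ.injective.ne hkl)

theorem neg_cases (S : NegStar P) {p q : P.Point} (h : P.neg p q) :
    ∃ j, (p = S.ℓ j ∧ q = S.c j) ∨ (q = S.ℓ j ∧ p = S.c j) := by
  rcases S.all p with hp | ⟨j, rfl⟩
  · rcases S.all q with hq | ⟨j, rfl⟩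
    · exact absurd (hp.trans hq.symm) (P.neg_var _ _ h)
    · exact ⟨j, Or.inr ⟨rfl, (S.neg_iff j p).1 (P.neg_symm _ _ h)⟩⟩
  · exact ⟨j, Or.inl ⟨rfl, (S.neg_iff j q).1 h⟩⟩

theorem pos_cases (S : NegStar P) {p q : P.Point} (h : P.pos p q) :
    ∃ j, (p = S.ℓ j ∧ P.var q = S.b) ∨ (q = S.ℓ j ∧ P.var p = S.b) := by
  rcases S.all p with hp | ⟨j, rfl⟩
  · rcases S.all q with hq | ⟨j, rfl⟩
    · exact absurd (hp.trans hq.symm) (P.pos_var _ _ h)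
    · exact ⟨j, Or.inr ⟨rfl, hp⟩⟩
  · exact ⟨j, Or.inl ⟨rfl, S.pos_var j q h⟩⟩

open Classical in
/-- The labels of the points in a pattern whose first point is `ℓ 0`, whose points of the second
variable are labelled by `f`, and whose last two points, `k` and `k'`, are `ℓ 1` and `ℓ 2`. -/
noncomputable def label (S : NegStar P) {n : ℕ} (z k k' : Fin n) (f : P.Point → Fin n)
    (p : P.Point) : Fin n :=
  if P.var p = S.b then f p else if p = S.ℓ 0 then z else if p = S.ℓ 1 then k else k'

/-- A pattern occurs in a listed pattern if the labels respect the negative edges and the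
positive edges at the leaves. -/
theorem occursIn_ofEdges (S : NegStar P) {n : ℕ} (z k k' : Fin n) (f : P.Point → Fin n)
    {u : Fin n → Fin 4} {E F : List (Fin n × Fin n)} {hu hd}
    (huz : u z = 0) (huk : u k = 2) (huk' : u k' = 3) (huf : ∀ p, u (f p) = 1)
    (hF : ∀ j, (f (S.c j), ![z, k, k'] j) ∈ F ∨ (![z, k, k'] j, f (S.c j)) ∈ F)
    (hE : ∀ j p, P.pos (S.ℓ j) p → (f p, ![z, k, k'] j) ∈ E ∨ (![z, k, k'] j, f p) ∈ E) :
    P.OccursIn (Pattern.ofEdges n u E F hu hd) := by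
  have hne : ∀ {i j}, i ≠ j → S.ℓ i ≠ S.ℓ j := fun hij h => hij (S.inj _ _ (by rw [h]))
  have hℓ : ∀ j, S.label z k k' f (S.ℓ j) = ![z, k, k'] j := by
    intro j
    fin_cases j <;> simp [label, S.var_ℓ, hne]
  have hb : ∀ p, P.var p = S.b → S.label z k k' f p = f p := fun p hp => by simp [label, hp]
  have hul : ∀ j, u (![z, k, k'] j) = ![0, 2, 3] j := by
    intro j
    fin_cases j <;> simpa
  refine ⟨S.label z k k' f, fun p q => ?_, fun p q h => ?_, fun p q h => ?_⟩
  · change u _ = u _ ↔ _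
    have hne1 : ∀ j : Fin 3, (![0, 2, 3] j : Fin 4) ≠ 1 := by decide
    have hinj : ∀ i j : Fin 3, (![0, 2, 3] i : Fin 4) = ![0, 2, 3] j → i = j := by decide
    rcases S.all p with hp | ⟨i, rfl⟩ <;> rcases S.all q with hq | ⟨j, rfl⟩
    · rw [hb p hp, hb q hq, huf, huf, hp, hq]
      exact ⟨fun _ => rfl, fun _ => rfl⟩
    · rw [hb p hp, hℓ, huf, hul, hp]
      exact ⟨fun h => absurd h.symm (hne1 j), fun h => absurd h.symm (S.var_ℓ j)⟩
    · rw [hb q hq, hℓ, huf, hul, hq]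
      exact ⟨fun h => absurd h (hne1 i), fun h => absurd h (S.var_ℓ i)⟩
    · rw [hℓ, hℓ, hul, hul]
      exact ⟨fun h => by rw [hinj _ _ h], fun h => by rw [S.inj _ _ h]⟩
  · obtain ⟨j, ⟨rfl, hq⟩ | ⟨rfl, hp⟩⟩ := S.pos_cases h
    · change (_, _) ∈ E ∨ (_, _) ∈ E
      rw [hℓ, hb q hq]
      exact (hE j q h).symm
    · change (_, _) ∈ E ∨ (_, _) ∈ E
      rw [hℓ, hb p hp]
      exact hE j p (P.pos_symm _ _ h)
  · obtain ⟨j, ⟨rfl, rfl⟩ | ⟨rfl, rfl⟩⟩ := S.neg_cases h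
    · change (_, _) ∈ F ∨ (_, _) ∈ F
      rw [hℓ, hb _ (S.var_c j)]
      exact (hF j).symm
    · change (_, _) ∈ F ∨ (_, _) ∈ F
      rw [hℓ, hb _ (S.var_c j)]
      exact hF j

/-- For distinct `c i` and `c j` to be told apart, one of them is joined to a leaf of the
other. -/
theorem exists_pos (S : NegStar P) (hirr : P.Irreducible) {i j : Fin 3} (h : S.c i ≠ S.c j) :
    (∃ k, S.c k = S.c j ∧ P.pos (S.ℓ k) (S.c i)) ∨ ∃ k, S.c k = S.c i ∧ P.pos (S.ℓ k) (S.c j) := by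
  obtain ⟨r, ⟨h1, h2⟩ | ⟨h1, h2⟩⟩ :=
    hirr.exists_separator h ((S.var_c i).trans (S.var_c j).symm)
  · obtain ⟨k, ⟨h3, h4⟩ | ⟨rfl, h4⟩⟩ := S.neg_cases h2
    · exact absurd (h3 ▸ S.var_c j) (S.var_ℓ k)
    · exact Or.inl ⟨k, h4.symm, P.pos_symm _ _ h1⟩
  · obtain ⟨k, ⟨h3, h4⟩ | ⟨rfl, h4⟩⟩ := S.neg_cases h1
    · exact absurd (h3 ▸ S.var_c i) (S.var_ℓ k)
    · exact Or.inr ⟨k, h4.symm, P.pos_symm _ _ h2⟩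

theorem not_pos (S : NegStar P) (j : Fin 3) : ¬ P.pos (S.ℓ j) (S.c j) := fun h =>
  P.pos_neg _ _ h ((S.neg_iff j _).2 rfl)

/-- If the points `c j` are distinct, the positive edges form a cycle through them and the leaves.
-/
theorem occurs_of_injective (S : NegStar P) (hirr : P.Irreducible) (h01 : S.c 0 ≠ S.c 1)
    (h02 : S.c 0 ≠ S.c 2) (h12 : S.c 1 ≠ S.c 2) : P.OccursIn patternQ1 := by
  have hinj : ∀ i j, S.c i = S.c j → i = j := by
    intro i j
    fin_cases i <;> fin_cases j <;> simp [h01, h02, h12, h01.symm, h02.symm, h12.symm]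
  have hpos : ∀ i j, i ≠ j → P.pos (S.ℓ j) (S.c i) ∨ P.pos (S.ℓ i) (S.c j) := by
    intro i j hij
    rcases S.exists_pos hirr (fun h => hij (hinj i j h)) with ⟨k, hk, h⟩ | ⟨k, hk, h⟩
    · exact Or.inl (hinj _ _ hk ▸ h)
    · exact Or.inr (hinj _ _ hk ▸ h)
  wlog h : P.pos (S.ℓ 0) (S.c 1) generalizing S
  · have hσ : ∀ i j, i ≠ j → Equiv.swap (0 : Fin 3) 1 i ≠ Equiv.swap 0 1 j := fun i j hij =>
      (Equiv.swap (0 : Fin 3) 1).injective.ne hij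
    refine this (S.reindex (Equiv.swap 0 1)) (fun h' => hσ 0 1 (by decide) (hinj _ _ h'))
      (fun h' => hσ 0 2 (by decide) (hinj _ _ h')) (fun h' => hσ 1 2 (by decide) (hinj _ _ h'))
      (fun i j h' => (Equiv.swap (0 : Fin 3) 1).injective (hinj _ _ h'))
      (fun i j hij => hpos _ _ (hσ i j hij)) ?_
    change P.pos (S.ℓ (Equiv.swap 0 1 0)) (S.c (Equiv.swap 0 1 1))
    simpa using (hpos 0 1 (by decide)).resolve_right h
  have h20 : P.pos (S.ℓ 2) (S.c 0) := (hpos 0 2 (by decide)).resolve_right fun h' =>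
    h12 (S.pos_unique 0 _ _ h h')
  have h12' : P.pos (S.ℓ 1) (S.c 2) := (hpos 1 2 (by decide)).resolve_left fun h' =>
    h01 (S.pos_unique 2 _ _ h20 h')
  classical
  refine S.occursIn_ofEdges 0 4 5 (fun p => if p = S.c 0 then 2 else if p = S.c 1 then 3 else 1)
    (by decide) (by decide) (by decide) (fun p => by split_ifs <;> decide) ?_ ?_
  · intro j
    fin_cases j <;> simp [h01.symm, h02.symm, h12.symm]
  · intro j p hp
    fin_cases j
    · rw [S.pos_unique 0 _ _ hp h]
      simp [h01.symm]
    · rw [S.pos_unique 1 _ _ hp h12']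
      simp [h02.symm, h12.symm]
    · rw [S.pos_unique 2 _ _ hp h20]
      simp

/-- If two of the points `c j` coincide, no further point of the center could be told apart from
them, and at most one of their leaves is joined to the third one. -/
theorem occurs_of_eq (S : NegStar P) (hirr : P.Irreducible) (h : S.c 0 = S.c 1) :
    P.OccursIn patternQ2 := by
  have h02 : S.c 0 ≠ S.c 2 := fun h' => S.not_all_eq ⟨h, h'⟩
  wlog h1 : ¬ P.pos (S.ℓ 1) (S.c 2) generalizing S
  · rw [not_not] at h1
    have h0 : ¬ P.pos (S.ℓ 0) (S.c 2) := fun h0 => S.half 0 1 (by decide) h 0 1 (by decide) _ h0 h1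
    refine this (S.reindex (Equiv.swap 0 1)) ?_ ?_ ?_
    · change S.c (Equiv.swap 0 1 0) = S.c (Equiv.swap 0 1 1)
      simpa using h.symm
    · change S.c (Equiv.swap 0 1 0) ≠ S.c (Equiv.swap 0 1 2)
      rw [show Equiv.swap (0 : Fin 3) 1 2 = 2 by decide]
      simpa [← h] using h02
    · change ¬ P.pos (S.ℓ (Equiv.swap 0 1 1)) (S.c (Equiv.swap 0 1 2))
      rw [show Equiv.swap (0 : Fin 3) 1 2 = 2 by decide]
      simpa using h0
  -- A third point of `b` would be joined to `ℓ 2` and to one of `ℓ 0` and `ℓ 1`.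
  have hb : ∀ x, P.var x = S.b → x = S.c 0 ∨ x = S.c 2 := by
    intro x hx
    by_contra! hne
    have key : ∀ i, x ≠ S.c i → ∃ k, S.c k = S.c i ∧ P.pos (S.ℓ k) x := by
      intro i hi
      obtain ⟨r, ⟨h1, h2⟩ | ⟨h1, h2⟩⟩ :=
        hirr.exists_separator hi (hx.trans (S.var_c i).symm)
      · obtain ⟨k, ⟨h3, h4⟩ | ⟨rfl, h4⟩⟩ := S.neg_cases h2
        · exact absurd (h3 ▸ S.var_c i) (S.var_ℓ k)
        · exact ⟨k, h4.symm, P.pos_symm _ _ h1⟩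
      · obtain ⟨k, ⟨h3, h4⟩ | ⟨rfl, h4⟩⟩ := S.neg_cases h1
        · exact absurd (h3 ▸ hx) (S.var_ℓ k)
        · fin_cases k
          exacts [absurd h4 hne.1, absurd (h4.trans h.symm) hne.1, absurd h4 hne.2]
    obtain ⟨k, hk, hkx⟩ := key 0 hne.1
    obtain ⟨l, hl, hlx⟩ := key 2 hne.2
    exact S.half 0 1 (by decide) h k l (fun hkl => h02 (hk.symm.trans (hkl ▸ hl))) x hkx hlx
  classical
  refine S.occursIn_ofEdges 0 3 4 (fun p => if p = S.c 0 then 2 else 1)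
    (by decide) (by decide) (by decide) (fun p => by split_ifs <;> decide) ?_ ?_
  · intro j
    fin_cases j <;> simp [← h, h02.symm]
  · intro j p hp
    have hne : p ≠ S.c j := fun h' => S.not_pos j (h' ▸ hp)
    rcases hb p (S.pos_var j p hp) with rfl | rfl <;> fin_cases j
    · exact absurd rfl hne
    · exact absurd h hne
    · simp
    · simp [h02.symm]
    · exact absurd hp h1
    · exact absurd rfl hne

theorem occurs (S : NegStar P) (hirr : P.Irreducible) :
    P.OccursIn patternQ1 ∨ P.OccursIn patternQ2 := by
  by_cases h01 : S.c 0 = S.c 1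
  · exact Or.inr (S.occurs_of_eq hirr h01)
  by_cases h02 : S.c 0 = S.c 2
  · refine Or.inr ((S.reindex (Equiv.swap 1 2)).occurs_of_eq hirr ?_)
    change S.c (Equiv.swap 1 2 0) = S.c (Equiv.swap 1 2 1)
    rw [show Equiv.swap (1 : Fin 3) 2 0 = 0 by decide]
    simpa using h02
  by_cases h12 : S.c 1 = S.c 2
  · refine Or.inr ((S.reindex (Equiv.swap 0 2)).occurs_of_eq hirr ?_)
    change S.c (Equiv.swap 0 2 0) = S.c (Equiv.swap 0 2 1)
    rw [show Equiv.swap (0 : Fin 3) 2 1 = 1 by decide]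
    simpa using h12.symm
  exact Or.inl (S.occurs_of_injective hirr h01 h02 h12)

end NegStar

/-! ### Shapes of irreducible monotone patterns -/

variable {P : Pattern}

namespace Pattern

/-- Every point is on an edge, and positive edges are parallel to negative ones. -/
theorem Irreducible.exists_linked (hirr : P.Irreducible) (hmono : P.IsMonotone) (p : P.Point) :
    ∃ q, P.Linked (P.var p) (P.var q) := by
  by_cases h : ∃ q, P.neg p q
  · obtain ⟨q, hq⟩ := h
    exact ⟨q, p, q, rfl, rfl, hq⟩
  · obtain ⟨q, _, -, hq, -⟩ := hirr.exists_two_pos (not_exists.1 h)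
    exact ⟨q, hmono.linked hq⟩

theorem SACSolvable.neg_unique (hsac : P.SACSolvable) (hirr : P.Irreducible) {p q p' q' : P.Point}
    (h : P.neg p q) (h' : P.neg p' q') (hp : P.var p = P.var p') (hq : P.var q = P.var q') :
    p = p' ∧ q = q' :=
  ⟨(hsac.exists_conflicts hirr).1 _ _ _ _ h h' hp hq,
    (hsac.exists_conflicts hirr).1 _ _ _ _ (P.neg_symm _ _ h) (P.neg_symm _ _ h') hq hp⟩

theorem Linked.apply_eq {v : P.Point → Fin 4} (hv : ∀ p q, v p = v q ↔ P.var p = P.var q)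
    {p q : P.Point} (h : P.Linked (P.var p) (P.var q)) :
    ∃ p' q', v p' = v p ∧ v q' = v q ∧ P.neg p' q' := by
  obtain ⟨p', q', hp, hq, hn⟩ := h
  exact ⟨p', q', (hv _ _).2 hp, (hv _ _).2 hq, hn⟩

end Pattern

/-- If the linked pairs of variables form a star with three leaves, each leaf has a single point,
since a point with two positive edges into the center would bound the number of leaves by two. -/
theorem exists_negStar (hmono : P.IsMonotone) (hirr : P.Irreducible) (hsac : P.SACSolvable)
    {v : P.Point → Fin 4} (hv : ∀ p q, v p = v q ↔ P.var p = P.var q) (ℓ c : Fin 3 → P.Point)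
    (hℓ : ∀ j, v (ℓ j) = ![0, 2, 3] j) (hc : ∀ j, v (c j) = 1) (hn : ∀ j, P.neg (ℓ j) (c j)) :
    Nonempty (NegStar P) := by
  obtain ⟨Z, hZ, -⟩ := hsac.exists_cells hirr hmono
  have hcb : ∀ p j, v p = 1 ↔ P.var p = P.var (c j) := fun p j => by rw [← hv, hc]
  have hinj : ∀ i j, P.var (ℓ i) = P.var (ℓ j) → i = j := by
    intro i j h
    rw [← hv, hℓ, hℓ] at h
    revert i j
    decide
  have hleaf : ∀ p, v p ≠ 1 → ∃ j, P.var p = P.var (ℓ j) := by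
    intro p hp
    have : ∀ x : Fin 4, x ≠ 1 → ∃ j, x = ![0, 2, 3] j := by decide
    obtain ⟨j, hj⟩ := this _ hp
    exact ⟨j, (hv _ _).1 (hj.trans (hℓ j).symm)⟩
  have hlink : ∀ j, P.Linked (P.var (c 0)) (P.var (ℓ j)) := fun j =>
    ⟨c j, ℓ j, (hcb _ 0).1 (hc j), rfl, P.neg_symm _ _ (hn j)⟩
  -- The leaves have the same colour, so that no two of them are linked.
  have hcenter : ∀ p q, v p ≠ 1 → P.Linked (P.var p) (P.var q) → P.var q = P.var (c 0) := by
    intro p q hp h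
    rw [← hcb]
    by_contra hq
    obtain ⟨i, hi⟩ := hleaf p hp
    obtain ⟨j, hj⟩ := hleaf q hq
    have h1 := hZ _ _ h
    have h2 := hZ _ _ (hlink i)
    have h3 := hZ _ _ (hlink j)
    rw [hi, hj] at h1
    tauto
  have hpos : ∀ p q q', v p ≠ 1 → P.pos p q → P.pos p q' → q = q' := by
    intro p q q' hp hq hq'
    by_contra hne
    have hqb := hcenter p q hp (hmono.linked hq)
    have hqb' := hcenter p q' hp (hmono.linked hq')
    have h := (hsac.hub_restrictions hirr hmono hq hq' hne (hqb.trans hqb'.symm)).2 _ _ _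
      (hqb ▸ hlink 0) (hqb ▸ hlink 1) (hqb ▸ hlink 2)
    rcases h with h | h | h <;> exact absurd (hinj _ _ h) (by decide)
  have hℓ1 : ∀ j, v (ℓ j) ≠ 1 := fun j h => P.neg_var _ _ (hn j) ((hcb _ j).1 h)
  refine ⟨⟨P.var (c 0), ℓ, c, fun j => (hcb _ 0).1 (hc j), fun j h => hℓ1 j ((hcb _ 0).2 h), hinj,
    fun p => ?_, fun j p => ⟨fun h => ?_, fun h => h ▸ hn j⟩,
    fun j p h => hcenter _ _ (hℓ1 j) (hmono.linked h), fun j p q => hpos _ _ _ (hℓ1 j), ?_, ?_⟩⟩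
  · rw [← hcb]
    by_cases hp : v p = 1
    · exact Or.inl hp
    refine Or.inr ?_
    obtain ⟨j, hj⟩ := hleaf p hp
    have h : ∃ q, P.neg p q := by
      by_contra h
      obtain ⟨q, q', hne, hq, hq'⟩ := hirr.exists_two_pos (not_exists.1 h)
      exact hne (hpos _ _ _ hp hq hq')
    obtain ⟨q, hq⟩ := h
    have hqb := hcenter p q hp ⟨p, q, rfl, rfl, hq⟩
    exact ⟨j, (hsac.neg_unique hirr hq (hn j) hj (hqb.trans ((hcb _ 0).1 (hc j)).symm)).1⟩
  · have hpb := hcenter _ p (hℓ1 j) ⟨ℓ j, p, rfl, rfl, h⟩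
    exact (hsac.neg_unique hirr h (hn j) rfl (hpb.trans ((hcb _ 0).1 (hc j)).symm)).2
  · rintro ⟨h1, h2⟩
    rcases (hsac.half_restrictions hirr).1 (c 0) (ℓ 0) (ℓ 1) (ℓ 2) (P.neg_symm _ _ (hn 0))
      (h1 ▸ P.neg_symm _ _ (hn 1)) (h2 ▸ P.neg_symm _ _ (hn 2)) with h | h | h <;>
      exact absurd (hinj _ _ h) (by decide)
  · intro i j hij h k l hkl x hk hl
    have hx : ∀ m, P.var x = P.var (c m) := fun m =>
      (hcenter _ x (hℓ1 k) (hmono.linked hk)).trans ((hcb _ 0).1 (hc m)).symm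
    exact hkl (hinj _ _ ((hsac.half_restrictions hirr).2 (c i) (ℓ i) (ℓ j)
      (P.neg_symm _ _ (hn i)) (h ▸ P.neg_symm _ _ (hn j)) (fun h' => hij (hinj _ _ h')) x (c k)
      (c l) (ℓ k) (ℓ l) (hx i) ((hx k).symm.trans (hx i)) ((hx l).symm.trans (hx i))
      (P.neg_symm _ _ (hn k)) (P.neg_symm _ _ (hn l)) (P.pos_symm _ _ hk) (P.pos_symm _ _ hl)))

/-- If every variable is linked to at most one other, there are no positive edges. -/
theorem occurs_of_disjoint_links (hmono : P.IsMonotone) (hirr : P.Irreducible)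
    (hsac : P.SACSolvable) {v : P.Point → Fin 4} (hv : ∀ p q, v p = v q ↔ P.var p = P.var q)
    (hneg : ∀ p q, P.neg p q → v p < v q → (v p = 0 ∧ v q = 1) ∨ (v p = 2 ∧ v q = 3)) :
    P.OccursIn patternR5 := by
  obtain ⟨Z, hZ, -, hsec, -⟩ := hsac.exists_cells hirr hmono
  have hpartner : ∀ p q q', P.Linked (P.var p) (P.var q) → P.Linked (P.var p) (P.var q') →
      P.var q = P.var q' := by
    have key : ∀ p q, P.Linked (P.var p) (P.var q) → (v p = 0 ∧ v q = 1) ∨ (v p = 1 ∧ v q = 0) ∨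
        (v p = 2 ∧ v q = 3) ∨ (v p = 3 ∧ v q = 2) := by
      intro p q h
      obtain ⟨p', q', hp, hq, hn⟩ := h.apply_eq hv
      have h1 := hneg p' q' hn
      have h2 := hneg q' p' (P.neg_symm _ _ hn)
      have h3 := mt (hv p' q').1 (P.neg_var _ _ hn)
      rw [hp, hq] at h1 h2 h3
      grind
    intro p q q' h h'
    rw [← hv]
    have := key p q h
    have := key p q' h'
    grind
  have hlink : ∀ {p q}, P.neg p q → P.Linked (P.var p) (P.var q) := fun h => ⟨_, _, rfl, rfl, h⟩
  have hneg_of : ∀ p, Z (P.var p) ∨ (∃ q, Z (P.var q) ∧ P.Linked (P.var p) (P.var q)) →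
      ∃ q, P.neg p q := by
    have hout : ∀ p, (∃ q, Z (P.var q) ∧ P.Linked (P.var p) (P.var q)) → ∃ q, P.neg p q := by
      rintro p ⟨q, hqZ, hpq⟩
      by_contra h
      obtain ⟨r, r', hne, hr, hr'⟩ := hirr.exists_two_pos (not_exists.1 h)
      have h1 := hpartner _ _ _ hpq (hmono.linked hr)
      have h2 := hpartner _ _ _ hpq (hmono.linked hr')
      exact hne (hsec r r' p (h1 ▸ hqZ) (h1.symm.trans h2) (P.pos_symm _ _ hr)
        (P.pos_symm _ _ hr'))
    rintro p (hp | hp)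
    · by_contra h
      obtain ⟨r, r', hne, hr, hr'⟩ := hirr.exists_two_pos (not_exists.1 h)
      obtain ⟨t, ht⟩ := hout r ⟨p, hp, (hmono.linked hr).symm⟩
      obtain ⟨t', ht'⟩ := hout r' ⟨p, hp, (hmono.linked hr').symm⟩
      have hrr := hpartner _ _ _ (hmono.linked hr) (hmono.linked hr')
      refine hne (hsac.neg_unique hirr ht ht' hrr ?_).1
      exact (hpartner _ _ _ (hlink ht) (hmono.linked hr).symm).trans
        (hpartner _ _ _ (hmono.linked hr').symm (hlink ht'))
    · exact hout p hp
  have hall : ∀ p, ∃ q, P.neg p q := by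
    intro p
    by_cases hp : Z (P.var p)
    · exact hneg_of p (Or.inl hp)
    · obtain ⟨q, hq⟩ := hirr.exists_linked hmono p
      exact hneg_of p (Or.inr ⟨q, not_not.1 fun h => hp ((hZ _ _ hq).2 h), hq⟩)
  have hpos : ∀ p q, ¬ P.pos p q := by
    intro p q h
    obtain ⟨t, ht⟩ := hall p
    obtain ⟨t', ht'⟩ := hall q
    have h1 := hpartner _ _ _ (hmono.linked h) (hlink ht)
    have h2 := hpartner _ _ _ (hmono.linked h).symm (hlink ht')
    have h3 := (hsac.neg_unique hirr ht (P.neg_symm _ _ ht') h2 h1.symm).2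
    exact P.pos_neg _ _ h (h3 ▸ ht)
  refine Pattern.occursIn_ofEdges hv v id (fun _ => rfl) (L := []) (M := [(0, 1), (2, 3)])
    (fun p q h => absurd h (hpos p q)) (fun p q h hlt => ?_) ![0, 2, 4, 5] (by decide) (by decide)
    (by simp)
  rcases hneg p q h hlt with ⟨h1, h2⟩ | ⟨h1, h2⟩ <;> simp [h1, h2]

namespace NegPath

/-- The variables in the opposite order, when `2` and `3` are linked. -/
def reverse (S : NegPath P) {c d : P.Point} (hc : S.v c = 2) (hd : S.v d = 3) (h : P.neg c d) :
    NegPath P where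
  v p := (S.v p).rev
  v_eq p q := by rw [Fin.rev_inj, S.v_eq]
  α := d
  β := c
  β' := S.γ
  γ := S.β'
  v_α := by rw [hd]; rfl
  v_β := by rw [hc]; rfl
  v_β' := by rw [S.v_γ]; rfl
  v_γ := by rw [S.v_β']; rfl
  neg_αβ := P.neg_symm _ _ h
  neg_βγ := P.neg_symm _ _ S.neg_βγ
  unique p q p' q' h1 h2 h3 h4 := S.unique _ _ _ _ h1 h2 (Fin.rev_injective h3)
    (Fin.rev_injective h4)
  neg_cases p q h hlt := by
    have := S.neg_cases q p (P.neg_symm _ _ h) (Fin.rev_lt_rev.1 hlt)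
    generalize S.v p = x at *
    generalize S.v q = y at *
    revert x y
    decide
  pos_cases p q h hlt := by
    have := S.pos_cases q p (P.pos_symm _ _ h) (Fin.rev_lt_rev.1 hlt)
    generalize S.v p = x at *
    generalize S.v q = y at *
    revert x y
    decide

theorem linked_αβ (S : NegPath P) : P.Linked (P.var S.α) (P.var S.β) := ⟨_, _, rfl, rfl, S.neg_αβ⟩

theorem linked_βγ (S : NegPath P) : P.Linked (P.var S.β) (P.var S.γ) :=
  ⟨S.β', S.γ, (S.v_eq _ _).1 (S.v_β'.trans S.v_β.symm), rfl, S.neg_βγ⟩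

theorem exists_neg_of_three (S : NegPath P) (hmono : P.IsMonotone) (hirr : P.Irreducible)
    {p : P.Point} (hp : S.v p = 3) : ∃ c d, S.v c = 2 ∧ S.v d = 3 ∧ P.neg c d := by
  obtain ⟨q, hq⟩ := hirr.exists_linked hmono p
  obtain ⟨d, c, hd, -, h⟩ := hq.apply_eq S.v_eq
  rw [hp] at hd
  refine ⟨c, d, ?_, hd, P.neg_symm _ _ h⟩
  have h1 := S.neg_cases d c h
  have h2 := S.neg_cases c d (P.neg_symm _ _ h)
  have h3 := mt (S.v_eq d c).1 (P.neg_var _ _ h)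
  rw [hd] at h1 h2 h3
  grind

/-- A set of variables that contains exactly one variable of each linked pair contains every
second variable of the path. -/
theorem colour (S : NegPath P) (hmono : P.IsMonotone) (hirr : P.Irreducible) {Z : P.Var → Prop}
    (hZ : ∀ x y, P.Linked x y → (Z x ↔ ¬ Z y)) :
    (∀ p, S.v p = 0 ∨ S.v p = 2 → Z (P.var p)) ∨ ∀ p, S.v p = 1 ∨ S.v p = 3 → Z (P.var p) := by
  have h1 := hZ _ _ S.linked_αβ
  have h2 := hZ _ _ S.linked_βγ
  by_cases hα : Z (P.var S.α)
  · refine Or.inl ?_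
    rintro p (hp | hp)
    · rwa [(S.v_eq p S.α).1 (hp.trans S.v_α.symm)]
    · rw [(S.v_eq p S.γ).1 (hp.trans S.v_γ.symm)]
      tauto
  · refine Or.inr ?_
    rintro p (hp | hp)
    · rw [(S.v_eq p S.β).1 (hp.trans S.v_β.symm)]
      tauto
    · obtain ⟨c, d, hc, hd, h⟩ := S.exists_neg_of_three hmono hirr hp
      have h3 := hZ _ _ ⟨c, d, rfl, rfl, h⟩
      rw [(S.v_eq p d).1 (hp.trans hd.symm)]
      rw [(S.v_eq c S.γ).1 (hc.trans S.v_γ.symm)] at h3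
      tauto

theorem occurs_of_eq (S : NegPath P) (hmono : P.IsMonotone) (hirr : P.Irreducible)
    (hsac : P.SACSolvable) (heq : S.β' = S.β) :
    P.OccursIn patternR1 ∨ P.OccursIn patternR2 ∨ P.OccursIn patternR3 ∨ P.OccursIn patternR4 := by
  obtain ⟨-, K, hK, hthree, hone⟩ := hsac.exists_conflicts hirr
  have hneg : P.neg S.β S.γ := heq ▸ S.neg_βγ
  have hαγ : P.var S.α ≠ P.var S.γ := by
    rw [Ne, ← S.v_eq, S.v_α, S.v_γ]
    decide
  have hKβ : ¬ K (P.var S.β) := fun h =>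
    hαγ (congrArg P.var (hone _ _ _ h (P.neg_symm _ _ S.neg_αβ) hneg))
  have hKγ : K (P.var S.γ) := not_not.1 fun h => hKβ ((hK _ _ S.linked_βγ).2 h)
  have T : SharedPath P :=
    { S with
      eq := heq
      neg_γ := fun q hq => hone _ _ _ hKγ hq (P.neg_symm _ _ hneg)
      half := fun x hx h1 h2 => by
        have hxβ := (S.v_eq x S.β).1 (hx.trans S.v_β.symm)
        exact hαγ ((hsac.half_restrictions hirr).2 S.β S.α S.γ (P.neg_symm _ _ S.neg_αβ) hneg hαγ x
          S.β S.β S.α S.γ hxβ rfl rfl (P.neg_symm _ _ S.neg_αβ) hneg h1 h2)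
      two := fun q r hq hr hqγ hrγ => by
        have hq' := (S.v_eq S.γ q).1 (S.v_γ.trans hq.symm)
        have hr' := (S.v_eq S.γ r).1 (S.v_γ.trans hr.symm)
        rcases hthree S.γ q r hKγ hq' hr' with h | h | h
        exacts [absurd h.symm hqγ, absurd h.symm hrγ, h] }
  obtain ⟨Z, hZ, -, hsec, -⟩ := hsac.exists_cells hirr hmono
  rcases T.colour hmono hirr hZ with h | h
  · rcases T.occurs_of_sec_even hirr fun p q r hp hpq =>
      hsec p q r (h p hp) ((T.v_eq _ _).1 hpq) with h | h
    exacts [Or.inl h, Or.inr (Or.inl h)]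
  · rcases T.occurs_of_sec_odd hirr fun p q r hp hpq =>
      hsec p q r (h p hp) ((T.v_eq _ _).1 hpq) with h | h | h
    exacts [Or.inl h, Or.inr (Or.inr (Or.inl h)), Or.inr (Or.inr (Or.inr h))]

theorem occurs_of_even (S : NegPath P) (hmono : P.IsMonotone) (hirr : P.Irreducible)
    (hsac : P.SACSolvable) (hne : S.β ≠ S.β') (hγ : ∀ q, P.neg S.γ q → q = S.β')
    (htwo : ∀ q r, S.v q = 2 → S.v r = 2 → q ≠ S.γ → r ≠ S.γ → q = r)
    (hsec : ∀ p q r, S.v p = 0 ∨ S.v p = 2 → S.v p = S.v q → P.pos p r → P.pos q r → p = q) :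
    P.OccursIn patternR5 ∨ P.OccursIn patternR6 ∨ P.OccursIn patternR7 ∨ P.OccursIn patternR8 ∨
      P.OccursIn patternR9 ∨ P.OccursIn patternR10 := by
  have T : SplitPath P :=
    { S with
      ne := hne
      neg_γ := hγ
      two := htwo
      sec := hsec
      hub := fun p q q' r s s' h1 h2 h3 h4 h5 h6 h7 h8 h9 h10 => by
        rw [S.v_eq]
        refine ((hsac.hub_restrictions hirr hmono h1 h2 h3 ?_).1 r s s' h6 h7 h8 ?_ ?_).symm
        · exact (S.v_eq _ _).1 (h4.trans h5.symm)
        · exact (S.v_eq _ _).1 (h9.trans h4.symm)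
        · exact (S.v_eq _ _).1 (h10.trans h4.symm) }
  exact T.occurs hirr

open Classical in
/-- If no point has a second positive edge to the variable `1` of a path `012`, the only points are
the ends of the two negative edges. -/
theorem occurs_of_short (S : NegPath P) (hirr : P.Irreducible) (hne : S.β ≠ S.β')
    (h3 : ∀ p, S.v p ≠ 3) (htwo : ∀ p, S.v p = 1 → p = S.β ∨ p = S.β')
    (hsec : ∀ p q r, S.v p = 1 → S.v p = S.v q → P.pos p r → P.pos q r → p = q) :
    P.OccursIn patternR5 := by
  have hsingle : ∀ p, S.v p = 0 ∨ S.v p = 2 → p = S.α ∨ p = S.γ := by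
    intro p hp
    have h : ∃ q, P.neg p q := by
      by_contra h
      obtain ⟨q, q', hqq, hq, hq'⟩ := hirr.exists_two_pos (not_exists.1 h)
      have h1 : S.v q = 1 := by
        have := S.pos_ends hq
        have := h3 q
        grind
      have h2 : S.v q' = 1 := by
        have := S.pos_ends hq'
        have := h3 q'
        grind
      exact hqq (hsec q q' p h1 (h1.trans h2.symm) (P.pos_symm _ _ hq) (P.pos_symm _ _ hq'))
    obtain ⟨q, hq⟩ := h
    have := S.neg_ends hq
    have := h3 q
    have := S.v_β
    have := S.v_β'
    grind
  have hβα := S.neg_αβ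
  have hβ := S.v_β
  have hβ' := S.v_β'
  have hα := S.v_α
  have hγ := S.v_γ
  refine Pattern.occursIn_ofEdges S.v_eq
    (fun p => if p = S.β then 1 else if S.v p = 1 then 2 else if S.v p = 0 then 0 else 3 :
      P.Point → Fin 4) ![0, 1, 1, 2] (fun p => ?_) (L := [(0, 2), (1, 3)]) (M := [(0, 1), (2, 3)])
    (fun p q h hlt => ?_) (fun p q h hlt => ?_) ![0, 2, 1, 3] (by decide) (by decide) ?_
  · have : S.v p = 0 ∨ S.v p = 1 ∨ S.v p = 2 := by
      have := h3 p
      generalize S.v p = x at *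
      revert x
      decide
    rcases this with h | h | h
    · have : p ≠ S.β := fun h' => by rw [h', hβ] at h; exact absurd h (by decide)
      simp [this, h]
    · by_cases h' : p = S.β <;> simp [h', h, hβ]
    · have : p ≠ S.β := fun h' => by rw [h', hβ] at h; exact absurd h (by decide)
      simp [this, h]
  · rcases S.pos_cases p q h hlt with ⟨hp, hq⟩ | ⟨hp, hq⟩ | ⟨-, hq⟩
    · have hpα : p = S.α := by grind
      have hqβ : q ≠ S.β := fun h' => P.pos_neg _ _ h (by rw [hpα, h']; exact hβα)
      have hpβ : p ≠ S.β := by grind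
      simp [hp, hq, hqβ, hpβ]
    · have hqγ : q = S.γ := by grind
      have hpβ : p = S.β := (htwo p hp).resolve_right fun h' =>
        P.pos_neg _ _ h (by rw [hqγ, h']; exact S.neg_βγ)
      have hqβ : q ≠ S.β := by grind
      simp [hpβ, hqβ, hq]
    · exact absurd hq (h3 q)
  · rcases S.neg_ends h with ⟨rfl, rfl⟩ | ⟨rfl, rfl⟩ | ⟨rfl, rfl⟩ | ⟨rfl, rfl⟩ | ⟨-, hq⟩ | ⟨hp, -⟩
    · have : S.α ≠ S.β := by grind
      simp [this, hα]
    · rw [hα, hβ] at hlt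
      exact absurd hlt (by decide)
    · have : S.γ ≠ S.β := by grind
      simp [this, hγ, hne.symm, hβ']
    · rw [hγ, hβ'] at hlt
      exact absurd hlt (by decide)
    · exact absurd hq (h3 q)
    · exact absurd hp (h3 p)
  · intro e he _
    fin_cases he <;> decide

/-- A common end of two negative edges can be moved to the first end of the path by reversing the
path. If there is none, and the even variables are not the cells, then reversing a path `0123` makes
them so. -/
theorem occurs (S : NegPath P) (hmono : P.IsMonotone) (hirr : P.Irreducible)
    (hsac : P.SACSolvable) :
    P.OccursIn patternR1 ∨ P.OccursIn patternR2 ∨ P.OccursIn patternR3 ∨ P.OccursIn patternR4 ∨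
      P.OccursIn patternR5 ∨ P.OccursIn patternR6 ∨ P.OccursIn patternR7 ∨ P.OccursIn patternR8 ∨
      P.OccursIn patternR9 ∨ P.OccursIn patternR10 := by
  by_cases heq : S.β' = S.β
  · have := S.occurs_of_eq hmono hirr hsac heq
    tauto
  by_cases hγ : ∃ d, P.neg S.γ d ∧ S.v d = 3
  · obtain ⟨d, hγd, hd⟩ := hγ
    have := (S.reverse S.v_γ hd hγd).occurs_of_eq hmono hirr hsac rfl
    tauto
  have hneg_γ : ∀ q, P.neg S.γ q → q = S.β' := by
    intro q hq
    have := S.neg_ends hq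
    have := S.v_γ
    have := S.v_α
    have := S.v_β
    have := S.v_β'
    grind
  obtain ⟨Z, hZ, hthree, hsec, -⟩ := hsac.exists_cells hirr hmono
  have htwo : ∀ p q r, Z (P.var p) → S.v p = S.v q → S.v p = S.v r → q ≠ p → r ≠ p → q = r :=
    fun p q r hp hq hr hqp hrp => by
      rcases hthree p q r hp ((S.v_eq _ _).1 hq) ((S.v_eq _ _).1 hr) with h | h | h
      exacts [absurd h.symm hqp, absurd h.symm hrp, h]
  rcases S.colour hmono hirr hZ with h | h
  · have := S.occurs_of_even hmono hirr hsac (Ne.symm heq) hneg_γ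
      (fun q r hq hr => htwo _ _ _ (h _ (Or.inr S.v_γ)) (S.v_γ.trans hq.symm)
        (S.v_γ.trans hr.symm))
      fun p q r hp hpq => hsec p q r (h p hp) ((S.v_eq _ _).1 hpq)
    tauto
  by_cases h3 : ∃ p, S.v p = 3
  · obtain ⟨p, hp⟩ := h3
    obtain ⟨c, d, hc, hd, hcd⟩ := S.exists_neg_of_three hmono hirr hp
    have hrev : ∀ x : Fin 4, (x.rev = 0 → x = 3) ∧ (x.rev = 2 → x = 1) := by decide
    have := (S.reverse hc hd hcd).occurs_of_even hmono hirr hsac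
      (fun h' => hγ ⟨d, by rw [← show c = S.γ from h']; exact hcd, hd⟩) ?_
      (fun q r hq hr => htwo _ _ _ (h _ (Or.inl S.v_β')) (S.v_β'.trans ((hrev _).2 hq).symm)
        (S.v_β'.trans ((hrev _).2 hr).symm))
      fun p q r hp hpq => hsec p q r (h p (hp.elim (fun h' => Or.inr ((hrev _).1 h'))
        fun h' => Or.inl ((hrev _).2 h'))) ((S.v_eq _ _).1 (Fin.rev_injective hpq))
    · tauto
    · intro q hq
      change P.neg S.β' q at hq
      change q = S.γ
      have := S.neg_ends hq
      have := S.v_γ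
      have := S.v_α
      have := S.v_β
      have := S.v_β'
      grind
  · have := S.occurs_of_short hirr (Ne.symm heq) (not_exists.1 h3)
      (fun p hp => by
        by_contra! hne
        exact hne.2 (htwo S.β p S.β' (h _ (Or.inl S.v_β)) (S.v_β.trans hp.symm)
          (S.v_β.trans S.v_β'.symm) hne.1 heq))
      fun p q r hp hpq => hsec p q r (h p (Or.inl hp)) ((S.v_eq _ _).1 hpq)
    tauto

end NegPath

end BinCSP

theorem mainTheorem3 (P : BinCSP.Pattern) (hmono : P.IsMonotone) (hirr : P.Irreducible)
    (hsac : P.SACSolvable) :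
    P.OccursIn BinCSP.patternQ1 ∨ P.OccursIn BinCSP.patternQ2 ∨
    P.OccursIn BinCSP.patternR1 ∨ P.OccursIn BinCSP.patternR2 ∨
    P.OccursIn BinCSP.patternR3 ∨ P.OccursIn BinCSP.patternR4 ∨
    P.OccursIn BinCSP.patternR5 ∨ P.OccursIn BinCSP.patternR6 ∨
    P.OccursIn BinCSP.patternR7 ∨ P.OccursIn BinCSP.patternR8 ∨
    P.OccursIn BinCSP.patternR9 ∨ P.OccursIn BinCSP.patternR10 := by
  obtain ⟨v, hv, h⟩ := hsac.exists_numbering hirr hmono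
  rcases h with ⟨p, q, r, p', q', r', ⟨hp, hq, hr, hp', hq', hr'⟩, h1, h2, h3⟩ | h |
    ⟨⟨p, q, r, s, ⟨hp, hq, hr, hs⟩, hpq, hrs⟩, hneg⟩
  · obtain ⟨S⟩ := BinCSP.exists_negStar hmono hirr hsac hv ![p', q', r'] ![p, q, r]
      (by intro j; fin_cases j <;> assumption) (by intro j; fin_cases j <;> assumption)
      (by
        intro j
        fin_cases j
        exacts [P.neg_symm _ _ h1, P.neg_symm _ _ h2, P.neg_symm _ _ h3])
    have := S.occurs hirr
    tauto
  · have := BinCSP.occurs_of_disjoint_links hmono hirr hsac hv h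
    tauto
  · have S : BinCSP.NegPath P :=
      { v := v
        v_eq := hv
        α := p
        β := q
        β' := r
        γ := s
        v_α := hp
        v_β := hq
        v_β' := hr
        v_γ := hs
        neg_αβ := hpq
        neg_βγ := hrs
        unique := fun p q p' q' h h' h1 h2 =>
          hsac.neg_unique hirr h h' ((hv _ _).1 h1) ((hv _ _).1 h2)
        neg_cases := hneg
        pos_cases := fun p q h hlt => by
          obtain ⟨p', q', h1, h2, h3⟩ := (hmono.linked h).apply_eq hv
          have := hneg p' q' h3
          rw [h1, h2] at this
          exact this hlt }
    have := S.occurs hmono hirr hsac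
    tauto
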